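/- Let $A=\left(\begin{smallmatrix}1&1\\0&1\end{smallmatrix}\right)$ act on $\mathbb T^2=\mathbb R^2/\mathbb Z^2$ with coordinates $(x,y)$, so $A(x,y)=(x+y,y)$. Let $M=(\mathbb T^2\times[0,1])/((t,0)\sim(At,1))$ be its suspension, a smooth manifold with universal cover $q:\mathbb R^2\times\mathbb R\to M$, $q(t,s)=q(At,s+1)$, and let $\mathcal F_A$ be the codimension two foliation of $M$ whose leaves are the images of the lines $\{t\}\times\mathbb R$. A smooth form $\alpha$ on $M$ is basic if $i_X\alpha=i_Xd\alpha=0$ for all $X$ tangent to the leaves; $\Omega^k(M/\mathcal F_A)$ is the space of basic $k$-forms. Then: 1. The form $\omega=dx\wedge dy$ on $\mathbb T^2$ is $A$-invariant, closed and non-degenerate, so $\mathcal F_A$ is transversely symplectic. For every $k$ there is a linear isomorphism from $\Omega^k(M/\mathcal F_A)$ onto the space of $A$-invariant smooth $k$-forms on $\mathbb T^2$ that maps $\alpha$ to $\tau$ with $q^*\alpha=\mathrm{pr}^*\tau$, where $\mathrm{pr}(t,s)=t$; it commutes with $d$. Basic forms are identified with invariant forms on $\mathbb T^2$ in this way from now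 on. 2. With $\mathbb S^1=\mathbb R/\mathbb Z$, $$\Omega^0=\{f(y)\},\quad \Omega^1=\{f(y)\,dy\},\quad \Omega^2=\{f(y)\,dx\wedge dy\},\qquad f\in C^\infty(\mathbb S^1),$$ where $f$ is determined by the form, and $\Omega^k=0$ for $k\ge 3$. 3. Let $G$ be the pairing on $k$-covectors induced by $\omega$ (on $1$-covectors, $G(\alpha,\beta)=\omega(\alpha^\sharp,\beta^\sharp)$ with $\omega(\alpha^\sharp,\cdot)=\alpha$; on $k$-covectors, $G(\alpha,\beta)=\frac1{k!}\sum G^{i_1j_1}\cdots G^{i_kj_k}\alpha_{i_1\dots i_k}\beta_{j_1\dots j_k}$). Let $*_s:\Omega^k\to\Omega^{2-k}$ be the symplectic star operator, defined pointwise by $\alpha\wedge *_s\beta=G(\alpha,\beta)\,\omega$ for all $k$-covectors $\alpha$, let $d^\Lambda=(-1)^{k+1}*_sd*_s$ on $\Omega^k$, and let $$H^\bullet=\frac{\ker d}{\operatorname{im}d},\qquad H^\bullet_{d+d^\Lambda}=\frac{\ker(d+d^\Lambda)}{\operatorname{im}dd^\Lambda},\qquad H^\bullet_{dd^\Lambda}=\frac{\ker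 dd^\Lambda}{\operatorname{im}d+\operatorname{im}d^\Lambda}.$$ Then, as real vector spaces, $$H^0\cong\mathbb R,\quad H^1\cong\mathbb R,\quad H^2\cong C^\infty(\mathbb S^1),$$ $$H^0_{d+d^\Lambda}\cong\mathbb R,\quad H^1_{d+d^\Lambda}\cong C^\infty(\mathbb S^1),\quad H^2_{d+d^\Lambda}\cong\mathbb R,$$ $$H^0_{dd^\Lambda}\cong C^\infty(\mathbb S^1),\quad H^1_{dd^\Lambda}\cong\mathbb R,\quad H^2_{dd^\Lambda}\cong C^\infty(\mathbb S^1).$$ Each isomorphism with $C^\infty(\mathbb S^1)$ maps the class of the form with coefficient $f$ to $f$. The isomorphisms of $H^0$, $H^0_{d+d^\Lambda}$ and $H^2_{d+d^\Lambda}$ with $\mathbb R$ map a class to the constant coefficient of its representing form, and those of $H^1$ and $H^1_{dd^\Lambda}$ map $[f(y)\,dy]$ to $\int_0^1f(y)\,dy$. In particular $H^2$, $H^1_{d+d^\Lambda}$, $H^0_{dd^\Lambda}$ and $H^2_{dd^\Lambda}$ are infinite dimensional. -/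

import Mathlib

open scoped Manifold ContDiff Topology

namespace Suspension

/-! ### The suspension manifold -/

/-- The plane, with coordinates `x = v 0` and `y = v 1`; the torus is its quotient by `ℤ²`. -/
abbrev Plane : Type := Fin 2 → ℝ

/-- The universal cover of the suspension, with points `(t, s)`, `t` in the plane. -/
abbrev Space : Type := Plane × ℝ

/-- The linear map with matrix `A = [[1, 1], [0, 1]]`, that is `(x, y) ↦ (x + y, y)`. -/
noncomputable def linA : Plane →L[ℝ] Plane :=
  LinearMap.toContinuousLinearMap (Matrix.toLin' !![1, 1; 0, 1])

theorem linA_apply (v : Plane) : linA v = ![v 0 + v 1, v 1] := by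
  ext i
  fin_cases i <;> simp [linA, Matrix.mulVec, dotProduct]

/-- The power `A ^ k`, `k ∈ ℤ`, as a linear map; see `shear_one` and `shear_add`. -/
noncomputable def shear (k : ℤ) : Plane →L[ℝ] Plane :=
  LinearMap.toContinuousLinearMap (Matrix.toLin' !![1, (k : ℝ); 0, 1])

theorem shear_apply (k : ℤ) (t : Plane) : shear k t = ![t 0 + k * t 1, t 1] := by
  ext i
  fin_cases i <;> simp [shear, Matrix.mulVec, dotProduct]

theorem shear_one : shear 1 = linA := by
  ext v i
  fin_cases i <;> simp [shear_apply, linA_apply]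

theorem shear_add (k l : ℤ) (t : Plane) : shear (k + l) t = shear k (shear l t) := by
  ext i
  fin_cases i
  · simp [shear_apply]; ring
  · simp [shear_apply]

/-- The group of deck transformations of `Space` over the suspension: the element `(m, n, k)`
stands for `(t, s) ↦ (A ^ k t + (m, n), s + k)`. It is generated by the two unit translations of
the plane, whose quotient is `T² × ℝ`, and by `(t, s) ↦ (A t, s + 1)`. -/
@[ext]
structure Deck : Type where
  m : ℤ
  n : ℤ
  k : ℤ

namespace Deck

instance : Group Deck where
  mul g h := ⟨g.m + h.m + g.k * h.n, g.n + h.n, g.k + h.k⟩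
  one := ⟨0, 0, 0⟩
  inv g := ⟨-g.m + g.k * g.n, -g.n, -g.k⟩
  mul_assoc a b c := by
    ext
    · change a.m + b.m + a.k * b.n + c.m + (a.k + b.k) * c.n
        = a.m + (b.m + c.m + b.k * c.n) + a.k * (b.n + c.n)
      ring
    · exact add_assoc _ _ _
    · exact add_assoc _ _ _
  one_mul a := by
    ext
    · change 0 + a.m + 0 * a.n = a.m
      ring
    · exact zero_add _
    · exact zero_add _
  mul_one a := by
    ext
    · change a.m + 0 + a.k * 0 = a.m
      ring
    · exact add_zero _
    · exact add_zero _
  inv_mul_cancel a := by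
    ext
    · change -a.m + a.k * a.n + a.m + -a.k * a.n = 0
      ring
    · exact neg_add_cancel _
    · exact neg_add_cancel _

theorem mul_def (g h : Deck) : g * h = ⟨g.m + h.m + g.k * h.n, g.n + h.n, g.k + h.k⟩ := rfl

theorem one_def : (1 : Deck) = ⟨0, 0, 0⟩ := rfl

noncomputable instance : MulAction Deck Space where
  smul g p := (shear g.k p.1 + ![(g.m : ℝ), (g.n : ℝ)], p.2 + g.k)
  one_smul p := by
    change (shear 0 p.1 + ![((0 : ℤ) : ℝ), ((0 : ℤ) : ℝ)], p.2 + ((0 : ℤ) : ℝ)) = p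
    ext i
    · fin_cases i <;> simp [shear_apply]
    · simp
  mul_smul g h p := by
    change (shear (g.k + h.k) p.1
        + ![((g.m + h.m + g.k * h.n : ℤ) : ℝ), ((g.n + h.n : ℤ) : ℝ)], p.2 + ((g.k + h.k : ℤ) : ℝ))
      = (shear g.k (shear h.k p.1 + ![(h.m : ℝ), (h.n : ℝ)]) + ![(g.m : ℝ), (g.n : ℝ)],
          p.2 + h.k + g.k)
    ext i
    · fin_cases i
      · simp [shear_apply]; ring
      · simp [shear_apply]; ring
    · simp; ring

theorem smul_def (g : Deck) (p : Space) :
    g • p = (shear g.k p.1 + ![(g.m : ℝ), (g.n : ℝ)], p.2 + g.k) := rfl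

instance : ContinuousConstSMul Deck Space where
  continuous_const_smul g := by
    simp only [smul_def]
    fun_prop

instance : IsCancelSMul Deck Space where
  left_cancel' g p q h := smul_left_cancel g h
  right_cancel' g h p e := by
    simp only [smul_def, Prod.mk.injEq, add_right_inj, Int.cast_inj] at e
    obtain ⟨e₁, e₂⟩ := e
    rw [e₂] at e₁
    have h₀ := congrFun e₁ 0
    have h₁ := congrFun e₁ 1
    simp at h₀ h₁
    ext
    · exact h₀
    · exact h₁
    · exact e₂

instance : ProperlyDiscontinuousSMul Deck Space where
  finite_disjoint_inter_image := by
    intro K L hK hL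
    obtain ⟨c, hc⟩ := hK.isBounded.exists_norm_le
    obtain ⟨d, hd⟩ := hL.isBounded.exists_norm_le
    obtain ⟨N, hN⟩ := exists_nat_ge (c + d + (c + d) * c)
    have hfin : (((Set.Icc (-(N : ℤ)) N) ×ˢ (Set.Icc (-(N : ℤ)) N)) ×ˢ
        (Set.Icc (-(N : ℤ)) N)).Finite :=
      ((Set.finite_Icc _ _).prod (Set.finite_Icc _ _)).prod (Set.finite_Icc _ _)
    refine (hfin.image (fun z : (ℤ × ℤ) × ℤ => (⟨z.1.1, z.1.2, z.2⟩ : Deck))).subset ?_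
    rintro g ⟨q, ⟨p, hp, rfl⟩, hq⟩
    have hp' := hc p hp
    have hq' := hd _ hq
    have hc0 : 0 ≤ c := (norm_nonneg _).trans hp'
    have hd0 : 0 ≤ d := (norm_nonneg _).trans hq'
    have hp1 := (norm_fst_le p).trans hp'
    have hp2 := (norm_snd_le p).trans hp'
    have hp10 := (norm_le_pi_norm p.1 0).trans hp1
    have hp11 := (norm_le_pi_norm p.1 1).trans hp1
    have hq1 := (norm_fst_le _).trans hq'
    have hq2 := (norm_snd_le _).trans hq'
    have hq10 := (norm_le_pi_norm _ 0).trans hq1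
    have hq11 := (norm_le_pi_norm _ 1).trans hq1
    simp [smul_def, shear_apply, Real.norm_eq_abs] at hp10 hp11 hp2 hq10 hq11 hq2
    have hk : |(g.k : ℝ)| ≤ c + d := by
      calc |(g.k : ℝ)| = |(p.2 + g.k) - p.2| := by ring_nf
        _ ≤ |p.2 + g.k| + |p.2| := abs_sub _ _
        _ ≤ c + d := by linarith
    have hn : |(g.n : ℝ)| ≤ c + d := by
      calc |(g.n : ℝ)| = |(p.1 1 + g.n) - p.1 1| := by ring_nf
        _ ≤ |p.1 1 + g.n| + |p.1 1| := abs_sub _ _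
        _ ≤ c + d := by linarith
    have hky : |(g.k : ℝ) * p.1 1| ≤ (c + d) * c := by
      rw [abs_mul]
      gcongr
    have hm : |(g.m : ℝ)| ≤ c + d + (c + d) * c := by
      calc |(g.m : ℝ)| = |(p.1 0 + g.k * p.1 1 + g.m) - (p.1 0 + g.k * p.1 1)| := by ring_nf
        _ ≤ |p.1 0 + g.k * p.1 1 + g.m| + |p.1 0 + g.k * p.1 1| := abs_sub _ _
        _ ≤ |p.1 0 + g.k * p.1 1 + g.m| + (|p.1 0| + |g.k * p.1 1|) := by
          gcongr; exact abs_add_le _ _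
        _ ≤ c + d + (c + d) * c := by linarith
    have hcd : 0 ≤ (c + d) * c := by positivity
    have key : ∀ z : ℤ, |(z : ℝ)| ≤ c + d + (c + d) * c → z ∈ Set.Icc (-(N : ℤ)) N := by
      intro z hz
      have := abs_le.1 (hz.trans hN)
      constructor
      · exact_mod_cast this.1
      · exact_mod_cast this.2
    exact ⟨((g.m, g.n), g.k), ⟨⟨key _ hm, key _ (by linarith)⟩, key _ (by linarith)⟩, rfl⟩

end Deck


instance : ChartedSpace Space Space := chartedSpaceSelf Space

/-- The suspension `(T² × [0, 1]) / ((t, 0) ∼ (A t, 1))`, as the quotient manifold of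
`ℝ² × ℝ` by the deck group. -/
def M : Type := MulAction.orbitRel.Quotient Deck Space

noncomputable instance : TopologicalSpace M :=
  inferInstanceAs (TopologicalSpace (MulAction.orbitRel.Quotient Deck Space))

noncomputable instance : ChartedSpace Space M :=
  inferInstanceAs (ChartedSpace Space (MulAction.orbitRel.Quotient Deck Space))

/-- The covering map. -/
noncomputable def proj (p : Space) : M := Quotient.mk (MulAction.orbitRel Deck Space) p

theorem exists_smul_of_proj_eq {p p' : Space} (h : proj p = proj p') : ∃ g : Deck, g • p = p' := by
  obtain ⟨g, hg⟩ := MulAction.orbitRel_apply.1 (Quotient.exact h.symm)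
  exact ⟨g, hg⟩

theorem proj_smul (g : Deck) (p : Space) : proj (g • p) = proj p :=
  Quotient.sound (MulAction.orbitRel_apply.2 ⟨g, rfl⟩)

theorem symm_eq_proj {e : OpenPartialHomeomorph M Space} (he : e ∈ atlas Space M) :
    (e.symm : Space → M) = proj := by
  obtain ⟨x, rfl⟩ := he
  rw [chartAt_self_eq, OpenPartialHomeomorph.trans_refl]
  exact IsLocalHomeomorph.localInverseAt_symm _ _

instance : IsManifold 𝓘(ℝ, Space) ∞ M := by
  apply isManifold_of_contDiffOn
  intro e e' he he' z hz
  have hs := symm_eq_proj he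
  have hs' := symm_eq_proj he'
  simp only [modelWithCornersSelf_coe, modelWithCornersSelf_coe_symm, Set.preimage_id_eq, id_eq,
    Set.range_id, Set.inter_univ, OpenPartialHomeomorph.trans_source,
    OpenPartialHomeomorph.symm_source, hs, Function.id_comp, Function.comp_id,
    OpenPartialHomeomorph.coe_trans] at hz ⊢
  obtain ⟨hz, hz'⟩ := hz
  have hw : proj (e' (proj z)) = proj z := by
    have h := e'.left_inv (show proj z ∈ e'.source from hz')
    rwa [hs'] at h
  obtain ⟨g, hg⟩ := exists_smul_of_proj_eq hw.symm
  have hcont : Continuous fun w : Space => g • w := continuous_const_smul g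
  have hnear : ∀ᶠ w in 𝓝 z, g • w ∈ e'.target := by
    refine hcont.continuousAt.eventually_mem (e'.open_target.mem_nhds ?_)
    simp only [hg]
    exact e'.map_source hz'
  have heq : (fun w => e' (proj w)) =ᶠ[𝓝 z] fun w => g • w := by
    filter_upwards [hnear] with w hw
    rw [← proj_smul g w, ← hs', e'.right_inv hw]
  have hsm : ContDiff ℝ ∞ fun w : Space => g • w := by
    simp only [Deck.smul_def]
    fun_prop
  exact (hsm.contDiffAt.congr_of_eventuallyEq heq).contDiffWithinAt

/-! ### Differential forms on a manifold modelled on a normed space -/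

section Forms

variable {E : Type*} [NormedAddCommGroup E] [NormedSpace ℝ E]
  {X : Type*} [TopologicalSpace X] [ChartedSpace E X]

/-- Differential `k`-forms on `X`, without any smoothness requirement. -/
abbrev DiffForm (E : Type*) [NormedAddCommGroup E] [NormedSpace ℝ E]
    (X : Type*) [TopologicalSpace X] [ChartedSpace E X] (k : ℕ) : Type _ :=
  (x : X) → TangentSpace 𝓘(ℝ, E) x [⋀^Fin k]→L[ℝ] ℝ

/-- The expression of a form in the preferred chart at `x`, that is, its pullback under the
inverse of the chart. -/
noncomputable def chartForm {k : ℕ} (α : DiffForm E X k) (x : X) (z : E) : E [⋀^Fin k]→L[ℝ] ℝ :=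
  (α ((chartAt E x).symm z)).compContinuousLinearMap
    (mfderiv 𝓘(ℝ, E) 𝓘(ℝ, E) (chartAt E x).symm z)

/-- Smoothness of a form, in charts. -/
def IsSmoothForm {k : ℕ} (α : DiffForm E X k) : Prop :=
  ∀ x : X, ContDiffOn ℝ ∞ (chartForm α x) (chartAt E x).target

/-- The exterior derivative of a form on a manifold: at `x` it is computed in the chart at `x`. -/
noncomputable def extDerivForm {k : ℕ} (α : DiffForm E X k) : DiffForm E X (k + 1) := fun x =>
  (extDeriv (chartForm α x) (chartAt E x x)).compContinuousLinearMap
    (mfderiv 𝓘(ℝ, E) 𝓘(ℝ, E) (chartAt E x) x)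

/-- `i_v α = 0` for all `v ∈ L`. As `α` is alternating, the slot in which `v` is inserted does not
matter; for `k = 0` there is no slot and no condition. -/
def Annihilates {V : Type*} [AddCommGroup V] [Module ℝ V] [TopologicalSpace V] {k : ℕ}
    (L : Submodule ℝ V) (α : V [⋀^Fin k]→L[ℝ] ℝ) : Prop :=
  ∀ w : Fin k → V, (∃ i, w i ∈ L) → α w = 0

theorem chartForm_add {k : ℕ} (α β : DiffForm E X k) (x : X) :
    chartForm (α + β) x = chartForm α x + chartForm β x := rfl

theorem chartForm_smul {k : ℕ} (c : ℝ) (α : DiffForm E X k) (x : X) :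
    chartForm (c • α) x = c • chartForm α x := rfl

theorem IsSmoothForm.differentiableAt {k : ℕ} {α : DiffForm E X k} (h : IsSmoothForm α) (x : X) :
    DifferentiableAt ℝ (chartForm α x) (chartAt E x x) :=
  (((h x).contDiffAt ((chartAt E x).open_target.mem_nhds (mem_chart_target E x)))).differentiableAt
    (by simp)

theorem extDerivForm_add {k : ℕ} {α β : DiffForm E X k} (hα : IsSmoothForm α)
    (hβ : IsSmoothForm β) : extDerivForm (α + β) = extDerivForm α + extDerivForm β := by
  funext x
  simp only [extDerivForm, Pi.add_apply, chartForm_add]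
  rw [extDeriv_add (hα.differentiableAt x) (hβ.differentiableAt x)]
  rfl

theorem extDerivForm_smul {k : ℕ} (c : ℝ) (α : DiffForm E X k) :
    extDerivForm (c • α) = c • extDerivForm α := by
  funext x
  simp only [extDerivForm, Pi.smul_apply, chartForm_smul]
  rw [extDeriv_smul]
  rfl

theorem extDerivForm_zero {k : ℕ} : extDerivForm (0 : DiffForm E X k) = 0 := by
  have := extDerivForm_smul (0 : ℝ) (0 : DiffForm E X k)
  rwa [zero_smul, zero_smul] at this

/-- The basic `k`-forms of a foliation with tangent spaces `D x`: smooth forms `α` with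
`i_v α = 0` and `i_v dα = 0` for all `v` tangent to the leaves. -/
def basicForms (D : (x : X) → Submodule ℝ (TangentSpace 𝓘(ℝ, E) x)) (k : ℕ) :
    Submodule ℝ (DiffForm E X k) where
  carrier := {α | IsSmoothForm α ∧
    ∀ x, Annihilates (D x) (α x) ∧ Annihilates (D x) (extDerivForm α x)}
  zero_mem' := by
    refine ⟨fun x => contDiffOn_const (c := 0), fun x => ⟨fun _ _ => rfl, fun w _ => ?_⟩⟩
    rw [extDerivForm_zero]
    rfl
  add_mem' := by
    rintro α β ⟨hα, hα'⟩ ⟨hβ, hβ'⟩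
    refine ⟨fun x => (hα x).add (hβ x), fun x => ⟨fun w hw => ?_, fun w hw => ?_⟩⟩
    · change α x w + β x w = 0
      rw [(hα' x).1 w hw, (hβ' x).1 w hw, add_zero]
    · rw [extDerivForm_add hα hβ]
      change extDerivForm α x w + extDerivForm β x w = 0
      rw [(hα' x).2 w hw, (hβ' x).2 w hw, add_zero]
  smul_mem' := by
    rintro c α ⟨hα, hα'⟩
    refine ⟨fun x => (hα x).const_smul c, fun x => ⟨fun w hw => ?_, fun w hw => ?_⟩⟩
    · change c • α x w = 0
      rw [(hα' x).1 w hw, smul_zero]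
    · rw [extDerivForm_smul]
      change c • extDerivForm α x w = 0
      rw [(hα' x).2 w hw, smul_zero]

end Forms

/-! ### The suspension foliation -/

/-- The leaf through `proj (t, 0)`, parametrized by `s ↦ proj (t, s)`. -/
noncomputable def leaf (t : Plane) (s : ℝ) : M := proj (t, s)

/-- The tangent line to the leaf through `x`, spanned by the velocities of the leaves at `x`. -/
noncomputable def leafTangent (x : M) : Submodule ℝ (TangentSpace 𝓘(ℝ, Space) x) :=
  Submodule.span ℝ {v | ∃ (t : Plane) (s : ℝ), leaf t s = x ∧
    (v : Space) = mfderiv 𝓘(ℝ, ℝ) 𝓘(ℝ, Space) (leaf t) s (1 : ℝ)}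

/-! ### The symplectic star on covectors of the transversal -/

section Sympl

/-- The symplectic form `dx ∧ dy`. -/
noncomputable def areaForm : Plane [⋀^Fin 2]→L[ℝ] ℝ where
  toMultilinearMap := (Matrix.detRowAlternating : Plane [⋀^Fin 2]→ₗ[ℝ] ℝ).toMultilinearMap
  map_eq_zero_of_eq' := (Matrix.detRowAlternating : Plane [⋀^Fin 2]→ₗ[ℝ] ℝ).map_eq_zero_of_eq'
  cont := Continuous.matrix_det continuous_id

theorem areaForm_apply (v : Fin 2 → Plane) : areaForm v = v 0 0 * v 1 1 - v 0 1 * v 1 0 :=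
  Matrix.det_fin_two (Matrix.of v)

/-- The wedge product of covectors. -/
noncomputable def wedge {k l : ℕ} (α : Plane [⋀^Fin k]→L[ℝ] ℝ) (β : Plane [⋀^Fin l]→L[ℝ] ℝ)
    (v : Fin (k + l) → Plane) : ℝ :=
  ((k.factorial : ℝ) * l.factorial)⁻¹ * ∑ σ : Equiv.Perm (Fin (k + l)),
    ((Equiv.Perm.sign σ : ℤ) : ℝ) *
      (α (fun i => v (σ (Fin.castAdd l i))) * β (fun j => v (σ (Fin.natAdd k j))))

/-- The basis `∂/∂x, ∂/∂y`. -/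
noncomputable def stdBasis (i : Fin 2) : Plane := Pi.single i 1

/-- The pairing that the symplectic form induces on 1-covectors, `G(dxᵢ, dxⱼ) = ω(dxᵢ♯, dxⱼ♯)` where
`ω(η♯, ·) = η`; its matrix is the inverse transpose of the matrix of `ω`. -/
noncomputable def poissonMatrix : Matrix (Fin 2) (Fin 2) ℝ :=
  (Matrix.of fun i j => areaForm ![stdBasis i, stdBasis j])⁻¹.transpose

/-- The extension of the pairing to `k`-covectors,
`G(α, β) = (1 / k!) ∑ G^{i₁j₁} ⋯ G^{iₖjₖ} α_{i₁…iₖ} β_{j₁…jₖ}`. -/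
noncomputable def pairing {k : ℕ} (α β : Plane [⋀^Fin k]→L[ℝ] ℝ) : ℝ :=
  ((k.factorial : ℝ))⁻¹ * ∑ i : Fin k → Fin 2, ∑ j : Fin k → Fin 2,
    (∏ a, poissonMatrix (i a) (j a)) * (α (fun a => stdBasis (i a)) * β (fun a => stdBasis (j a)))

/-- `γ` is the symplectic star of `β`: `α ∧ γ = G(α, β) ω` for all `k`-covectors `α`. -/
def IsStar {k l : ℕ} (h : k + l = 2) (β : Plane [⋀^Fin k]→L[ℝ] ℝ)
    (γ : Plane [⋀^Fin l]→L[ℝ] ℝ) : Prop :=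
  ∀ (α : Plane [⋀^Fin k]→L[ℝ] ℝ) (v : Fin (k + l) → Plane),
    wedge α γ v = pairing α β * areaForm (fun i => v (Fin.cast h.symm i))

theorem poissonMatrix_eq : poissonMatrix = !![0, 1; -1, 0] := by
  have h : (Matrix.of fun i j => areaForm ![stdBasis i, stdBasis j]) = !![0, 1; -1, 0] := by
    ext i j
    fin_cases i <;> fin_cases j <;> simp [areaForm_apply, stdBasis]
  rw [poissonMatrix, h, Matrix.inv_def, Matrix.adjugate_fin_two]
  ext i j
  fin_cases i <;> fin_cases j <;> simp [Matrix.det_fin_two]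

theorem sum_perm_two (f : Equiv.Perm (Fin 2) → ℝ) : ∑ σ, f σ = f 1 + f (Equiv.swap 0 1) := by
  have : (Finset.univ : Finset (Equiv.Perm (Fin 2))) = {1, Equiv.swap 0 1} := by decide
  rw [this, Finset.sum_pair (by decide)]


theorem wedge_add {k l : ℕ} (α : Plane [⋀^Fin k]→L[ℝ] ℝ) (γ γ' : Plane [⋀^Fin l]→L[ℝ] ℝ)
    (v : Fin (k + l) → Plane) : wedge α (γ + γ') v = wedge α γ v + wedge α γ' v := by
  simp only [wedge, ContinuousAlternatingMap.add_apply, mul_add, Finset.sum_add_distrib]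

theorem wedge_smul {k l : ℕ} (c : ℝ) (α : Plane [⋀^Fin k]→L[ℝ] ℝ) (γ : Plane [⋀^Fin l]→L[ℝ] ℝ)
    (v : Fin (k + l) → Plane) : wedge α (c • γ) v = c * wedge α γ v := by
  simp only [wedge, ContinuousAlternatingMap.smul_apply, smul_eq_mul, Finset.mul_sum]
  refine Finset.sum_congr rfl fun σ _ => ?_
  ring

theorem pairing_add {k : ℕ} (α β β' : Plane [⋀^Fin k]→L[ℝ] ℝ) :
    pairing α (β + β') = pairing α β + pairing α β' := by
  simp only [pairing, ContinuousAlternatingMap.add_apply, mul_add, Finset.sum_add_distrib]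

theorem pairing_smul {k : ℕ} (c : ℝ) (α β : Plane [⋀^Fin k]→L[ℝ] ℝ) :
    pairing α (c • β) = c * pairing α β := by
  simp only [pairing, ContinuousAlternatingMap.smul_apply, smul_eq_mul, Finset.mul_sum]
  refine Finset.sum_congr rfl fun σ _ => Finset.sum_congr rfl fun σ _ => ?_
  ring

theorem alt_two_apply (γ : Plane [⋀^Fin 2]→L[ℝ] ℝ) (v : Fin 2 → Plane) :
    γ v = γ stdBasis * areaForm v := by
  have h := AlternatingMap.eq_smul_basis_det (Pi.basisFun ℝ (Fin 2)) γ.toAlternatingMap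
  have h' := DFunLike.congr_fun h v
  have e : (⇑(Pi.basisFun ℝ (Fin 2)) : Fin 2 → Plane) = stdBasis := by
    funext i
    simp [stdBasis]
  rw [e, Pi.basisFun_det] at h'
  exact h'

theorem eq_const (γ : Plane [⋀^Fin 0]→L[ℝ] ℝ) (v w : Fin 0 → Plane) : γ v = γ w :=
  congrArg γ (Subsingleton.elim _ _)

theorem pairing_zero (α β : Plane [⋀^Fin 0]→L[ℝ] ℝ) (v : Fin 0 → Plane) :
    pairing α β = α v * β v := by
  simp only [pairing]
  simp
  rw [eq_const α _ v, eq_const β _ v]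

theorem pairing_one (α β : Plane [⋀^Fin 1]→L[ℝ] ℝ) :
    pairing α β = α ![stdBasis 0] * β ![stdBasis 1] - α ![stdBasis 1] * β ![stdBasis 0] := by
  have key : ∀ (f : (Fin 1 → Fin 2) → ℝ), ∑ i, f i = f ![0] + f ![1] := by
    intro f
    rw [← (Equiv.funUnique (Fin 1) (Fin 2)).symm.sum_comp, Fin.sum_univ_two]
    congr 2 <;> (ext i; fin_cases i; rfl)
  have e : ∀ i : Fin 2, (fun a : Fin 1 => stdBasis (![i] a)) = ![stdBasis i] := by
    intro i; ext a; fin_cases a; rfl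
  simp only [pairing, key, poissonMatrix_eq, e]
  simp
  ring

theorem pairing_two (α β : Plane [⋀^Fin 2]→L[ℝ] ℝ) :
    pairing α β = α stdBasis * β stdBasis := by
  have key : ∀ (f : (Fin 2 → Fin 2) → ℝ),
      ∑ i, f i = f ![0, 0] + f ![0, 1] + f ![1, 0] + f ![1, 1] := by
    intro f
    rw [← (finTwoArrowEquiv (Fin 2)).symm.sum_comp, Fintype.sum_prod_type, Fin.sum_univ_two,
      Fin.sum_univ_two, Fin.sum_univ_two, ← add_assoc]
    rfl
  have hα := alt_two_apply α
  have hβ := alt_two_apply β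
  generalize α stdBasis = a at hα ⊢
  generalize β stdBasis = b at hβ ⊢
  simp only [pairing, key, poissonMatrix_eq, hα, hβ, areaForm_apply]
  simp [stdBasis]
  ring

theorem wedge_zero_two (α : Plane [⋀^Fin 0]→L[ℝ] ℝ) (γ : Plane [⋀^Fin 2]→L[ℝ] ℝ)
    (v : Fin (0 + 2) → Plane) (u : Fin 0 → Plane) : wedge α γ v = α u * γ v := by
  have h := sum_perm_two fun σ => ((Equiv.Perm.sign σ : ℤ) : ℝ) *
      (α (fun i => v (σ (Fin.castAdd 2 i))) * γ (fun j => v (σ (Fin.natAdd 0 j))))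
  have h0 : γ (fun j => v ((1 : Equiv.Perm (Fin 2)) (Fin.natAdd 0 j))) = γ v := by
    congr 1; funext j; fin_cases j <;> rfl
  have h1 : γ (fun j => v ((Equiv.swap 0 1 : Equiv.Perm (Fin 2)) (Fin.natAdd 0 j))) = - γ v := by
    refine Eq.trans (congrArg γ ?_) (γ.map_swap v (i := 0) (j := 1) (by decide))
    funext j; fin_cases j <;> rfl
  rw [wedge]
  refine (congrArg _ h).trans ?_
  rw [h0, h1, eq_const α _ u,
    eq_const α (fun i => v ((Equiv.swap 0 1 : Equiv.Perm (Fin 2)) (Fin.castAdd 2 i))) u,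
    Equiv.Perm.sign_one, Equiv.Perm.sign_swap (by decide)]
  simp only [Nat.factorial, Units.val_one, Units.val_neg, Int.cast_neg, Int.cast_one]
  push_cast
  ring

theorem wedge_one_one (α γ : Plane [⋀^Fin 1]→L[ℝ] ℝ)
    (v : Fin (1 + 1) → Plane) : wedge α γ v = α ![v 0] * γ ![v 1] - α ![v 1] * γ ![v 0] := by
  have h := sum_perm_two fun σ => ((Equiv.Perm.sign σ : ℤ) : ℝ) *
      (α (fun i => v (σ (Fin.castAdd 1 i))) * γ (fun j => v (σ (Fin.natAdd 1 j))))
  have e : ∀ (f : Fin 1 → Plane), f = ![f 0] := by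
    intro f; funext i; fin_cases i; rfl
  rw [wedge]
  refine (congrArg _ h).trans ?_
  rw [e fun i => v ((1 : Equiv.Perm (Fin 2)) (Fin.castAdd 1 i)),
    e fun i => v ((1 : Equiv.Perm (Fin 2)) (Fin.natAdd 1 i)),
    e fun i => v ((Equiv.swap 0 1 : Equiv.Perm (Fin 2)) (Fin.castAdd 1 i)),
    e fun i => v ((Equiv.swap 0 1 : Equiv.Perm (Fin 2)) (Fin.natAdd 1 i))]
  have e0 : (Fin.castAdd 1 (0 : Fin 1)) = (0 : Fin 2) := rfl
  have e1 : (Fin.natAdd 1 (0 : Fin 1)) = (1 : Fin 2) := rfl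
  simp only [e0, e1]
  simp
  ring

theorem wedge_two_zero (α : Plane [⋀^Fin 2]→L[ℝ] ℝ) (γ : Plane [⋀^Fin 0]→L[ℝ] ℝ)
    (v : Fin (2 + 0) → Plane) (u : Fin 0 → Plane) : wedge α γ v = α v * γ u := by
  have h := sum_perm_two fun σ => ((Equiv.Perm.sign σ : ℤ) : ℝ) *
      (α (fun i => v (σ (Fin.castAdd 0 i))) * γ (fun j => v (σ (Fin.natAdd 2 j))))
  have h0 : α (fun j => v ((1 : Equiv.Perm (Fin 2)) (Fin.castAdd 0 j))) = α v := rfl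
  have h1 : α (fun j => v ((Equiv.swap 0 1 : Equiv.Perm (Fin 2)) (Fin.castAdd 0 j))) = - α v :=
    α.map_swap v (i := 0) (j := 1) (by decide)
  rw [wedge]
  refine (congrArg _ h).trans ?_
  rw [h0, h1, eq_const γ _ u,
    eq_const γ (fun j => v ((Equiv.swap 0 1 : Equiv.Perm (Fin 2)) (Fin.natAdd 2 j))) u,
    Equiv.Perm.sign_one, Equiv.Perm.sign_swap (by decide)]
  simp only [Nat.factorial, Units.val_one, Units.val_neg, Int.cast_neg, Int.cast_one]
  push_cast
  ring

theorem isStar_zero_iff (β : Plane [⋀^Fin 0]→L[ℝ] ℝ) (γ : Plane [⋀^Fin 2]→L[ℝ] ℝ) :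
    IsStar (k := 0) (l := 2) rfl β γ ↔ γ = β 0 • areaForm := by
  constructor
  · intro h
    ext v
    have := h (ContinuousAlternatingMap.constOfIsEmpty ℝ Plane (Fin 0) 1) v
    rw [wedge_zero_two _ _ _ 0, pairing_zero _ _ 0] at this
    simpa using this
  · rintro rfl α v
    rw [wedge_zero_two _ _ _ 0, pairing_zero _ _ 0]
    simp [mul_assoc]

theorem isStar_one_iff (β γ : Plane [⋀^Fin 1]→L[ℝ] ℝ) :
    IsStar (k := 1) (l := 1) rfl β γ ↔ γ = β := by
  have lin : ∀ (α : Plane [⋀^Fin 1]→L[ℝ] ℝ) (u : Plane),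
      α ![u] = u 0 * α ![stdBasis 0] + u 1 * α ![stdBasis 1] := by
    intro α u
    have e : ∀ w : Plane, α ![w] = (ContinuousAlternatingMap.ofSubsingleton ℝ Plane ℝ 0).symm α w := by
      intro w
      simp
      congr 1
      funext i
      fin_cases i
      rfl
    have hu : u = u 0 • stdBasis 0 + u 1 • stdBasis 1 := by
      ext i
      fin_cases i <;> simp [stdBasis]
    rw [e, e, e]
    conv_lhs => rw [hu]
    rw [map_add, map_smul, map_smul, smul_eq_mul, smul_eq_mul]
  constructor
  · intro h
    have key : ∀ u : Plane, γ ![u] = β ![u] := by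
      have h0 := fun α => h α ![stdBasis 0, stdBasis 1]
      simp only [wedge_one_one, pairing_one, areaForm_apply] at h0
      intro u
      rw [lin γ, lin β]
      have d0 := h0 (ContinuousAlternatingMap.ofSubsingleton ℝ Plane ℝ 0
        (ContinuousLinearMap.proj 0))
      have d1 := h0 (ContinuousAlternatingMap.ofSubsingleton ℝ Plane ℝ 0
        (ContinuousLinearMap.proj 1))
      simp [stdBasis] at d0 d1
      simp [stdBasis, d0, d1]
    ext w
    have hw : w = ![w 0] := by
      funext i
      fin_cases i
      rfl
    rw [hw]
    exact key _
  · rintro rfl α v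
    rw [wedge_one_one, pairing_one, areaForm_apply, lin α (v 0), lin α (v 1), lin γ (v 0),
      lin γ (v 1)]
    change _ = _ * (v 0 0 * v 1 1 - v 0 1 * v 1 0)
    ring

theorem isStar_two_iff (β : Plane [⋀^Fin 2]→L[ℝ] ℝ) (γ : Plane [⋀^Fin 0]→L[ℝ] ℝ) :
    IsStar (k := 2) (l := 0) rfl β γ ↔
      γ = ContinuousAlternatingMap.constOfIsEmpty ℝ Plane (Fin 0) (β stdBasis) := by
  have h1 : areaForm stdBasis = 1 := by simp [areaForm_apply, stdBasis]
  constructor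
  · intro h
    ext v
    have := h areaForm stdBasis
    rw [wedge_two_zero _ _ _ v, pairing_two, h1] at this
    change 1 * γ v = 1 * β stdBasis * areaForm stdBasis at this
    rw [h1] at this
    simpa using this
  · rintro rfl α v
    rw [wedge_two_zero _ _ _ 0, pairing_two, alt_two_apply α v]
    simp
    ring_nf

theorem exists_unique_isStar {k l : ℕ} (h : k + l = 2) (β : Plane [⋀^Fin k]→L[ℝ] ℝ) :
    ∃! γ : Plane [⋀^Fin l]→L[ℝ] ℝ, IsStar h β γ := by
  obtain ⟨rfl, rfl⟩ | ⟨rfl, rfl⟩ | ⟨rfl, rfl⟩ :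
      (k = 0 ∧ l = 2) ∨ (k = 1 ∧ l = 1) ∨ (k = 2 ∧ l = 0) := by omega
  · simp only [isStar_zero_iff]
    exact ⟨_, rfl, fun _ e => e⟩
  · simp only [isStar_one_iff]
    exact ⟨_, rfl, fun _ e => e⟩
  · simp only [isStar_two_iff]
    exact ⟨_, rfl, fun _ e => e⟩

/-- The symplectic star operator on covectors. -/
noncomputable def starCovector {k l : ℕ} (h : k + l = 2) :
    (Plane [⋀^Fin k]→L[ℝ] ℝ) →ₗ[ℝ] (Plane [⋀^Fin l]→L[ℝ] ℝ) where
  toFun β := (exists_unique_isStar h β).choose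
  map_add' β β' := by
    refine ((exists_unique_isStar h (β + β')).choose_spec.2 _ fun α v => ?_).symm
    rw [wedge_add, (exists_unique_isStar h β).choose_spec.1 α v,
      (exists_unique_isStar h β').choose_spec.1 α v, pairing_add, add_mul]
  map_smul' c β := by
    refine ((exists_unique_isStar h (c • β)).choose_spec.2 _ fun α v => ?_).symm
    rw [RingHom.id_apply, wedge_smul, (exists_unique_isStar h β).choose_spec.1 α v, pairing_smul,
      mul_assoc]

theorem isStar_starCovector {k l : ℕ} (h : k + l = 2) (β : Plane [⋀^Fin k]→L[ℝ] ℝ) :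
    IsStar h β (starCovector h β) := (exists_unique_isStar h β).choose_spec.1


instance (k : ℕ) : FiniteDimensional ℝ (Plane [⋀^Fin k]→L[ℝ] ℝ) := by
  let f : (Plane [⋀^Fin k]→L[ℝ] ℝ) →ₗ[ℝ] MultilinearMap ℝ (fun _ : Fin k => Plane) ℝ :=
    { toFun := fun γ => γ.toMultilinearMap
      map_add' := fun _ _ => rfl
      map_smul' := fun _ _ => rfl }
  refine FiniteDimensional.of_injective f fun γ γ' h => ?_
  ext v
  exact DFunLike.congr_fun h v

theorem starCovector_comp {k l : ℕ} (h : k + l = 2) (β : Plane [⋀^Fin k]→L[ℝ] ℝ) :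
    (starCovector h β).compContinuousLinearMap linA
      = starCovector h (β.compContinuousLinearMap linA) := by
  have hA : ∀ v : Fin 2 → Plane, areaForm (fun i => linA (v i)) = areaForm v := by
    intro v
    simp [areaForm_apply, linA_apply]
    ring
  have h₁ := isStar_starCovector h β
  have h₂ := isStar_starCovector h (β.compContinuousLinearMap linA)
  obtain ⟨rfl, rfl⟩ | ⟨rfl, rfl⟩ | ⟨rfl, rfl⟩ :
      (k = 0 ∧ l = 2) ∨ (k = 1 ∧ l = 1) ∨ (k = 2 ∧ l = 0) := by omega
  · rw [(isStar_zero_iff _ _).1 h₁, (isStar_zero_iff _ _).1 h₂]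
    ext v
    change β 0 * areaForm (fun i => linA (v i)) = β _ * areaForm v
    rw [hA, eq_const β 0]
  · rw [(isStar_one_iff _ _).1 h₁, (isStar_one_iff _ _).1 h₂]
  · rw [(isStar_two_iff _ _).1 h₁, (isStar_two_iff _ _).1 h₂]
    ext v
    change β stdBasis = β fun i => linA (stdBasis i)
    rw [alt_two_apply β fun i => linA (stdBasis i), hA]
    simp [areaForm_apply, stdBasis]

/-! ### Invariant forms on the transversal and their cohomologies -/

/-- Smooth `k`-forms on the torus `ℝ² / ℤ²`, i.e. `ℤ²`-periodic forms on the plane, that are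
invariant under the holonomy, which is generated by `A`. -/
def transverseForms (k : ℕ) : Submodule ℝ (Plane → Plane [⋀^Fin k]→L[ℝ] ℝ) where
  carrier := {τ | ContDiff ℝ ∞ τ ∧
    (∀ (n : Fin 2 → ℤ) (v : Plane), τ (v + fun i => (n i : ℝ)) = τ v) ∧
    ∀ v : Plane, (τ (linA v)).compContinuousLinearMap linA = τ v}
  zero_mem' := ⟨contDiff_const, fun _ _ => rfl, fun _ => rfl⟩
  add_mem' := by
    rintro τ τ' ⟨h₁, h₂, h₃⟩ ⟨h₁', h₂', h₃'⟩
    refine ⟨h₁.add h₁', fun n v => ?_, fun v => ?_⟩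
    · rw [Pi.add_apply, Pi.add_apply, h₂, h₂']
    · rw [Pi.add_apply τ τ' v, ← h₃ v, ← h₃' v]
      rfl
  smul_mem' := by
    rintro c τ ⟨h₁, h₂, h₃⟩
    refine ⟨contDiff_const.smul h₁, fun n v => ?_, fun v => ?_⟩
    · rw [Pi.smul_apply, Pi.smul_apply, h₂]
    · rw [Pi.smul_apply c τ v, ← h₃ v]
      rfl

/-- The space `Ωᵏ(M/F)`, seen as the space of invariant forms on the transversal. -/
def TransverseForm (k : ℕ) : Type := transverseForms k

noncomputable instance (k : ℕ) : AddCommGroup (TransverseForm k) :=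
  inferInstanceAs (AddCommGroup (transverseForms k))

noncomputable instance (k : ℕ) : Module ℝ (TransverseForm k) :=
  inferInstanceAs (Module ℝ (transverseForms k))

/-- The exterior derivative of invariant forms. -/
noncomputable def dT (k : ℕ) : TransverseForm k →ₗ[ℝ] TransverseForm (k + 1) where
  toFun τ := ⟨extDeriv τ.1, by
    obtain ⟨τ, h₁, h₂, h₃⟩ := τ
    have hd : Differentiable ℝ τ := h₁.differentiable (by simp)
    refine ⟨?_, fun n v => ?_, fun v => ?_⟩
    · exact (ContinuousAlternatingMap.alternatizeUncurryFinCLM ℝ Plane ℝ).contDiff.comp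
        (h₁.fderiv_right (m := ∞) (by simp))
    · have : (fun w => τ (w + fun i => (n i : ℝ))) = τ := funext (h₂ n)
      simp only [extDeriv]
      rw [← fderiv_comp_add_right, this]
    · have h := extDeriv_pullback (f := linA) (x := v) (r := ∞) (hd (linA v))
        linA.contDiff.contDiffAt (by simp; exact WithTop.coe_le_coe.2 le_top)
      simp only [ContinuousLinearMap.fderiv, h₃] at h
      exact h.symm⟩
  map_add' τ τ' := by
    refine Subtype.ext (funext fun v => ?_)
    exact extDeriv_add ((τ.2.1.differentiable (by simp)) v) ((τ'.2.1.differentiable (by simp)) v)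
  map_smul' c τ := by
    refine Subtype.ext (funext fun v => ?_)
    exact extDeriv_smul c τ.1

/-- The symplectic star operator `Ωᵏ → Ω²⁻ᵏ`. -/
noncomputable def starT {k l : ℕ} (h : k + l = 2) : TransverseForm k →ₗ[ℝ] TransverseForm l where
  toFun τ := ⟨fun v => starCovector h (τ.1 v), by
    obtain ⟨τ, h₁, h₂, h₃⟩ := τ
    refine ⟨?_, fun n v => ?_, fun v => ?_⟩
    · exact (LinearMap.toContinuousLinearMap (starCovector h)).contDiff.comp h₁
    · simp only [h₂]
    · rw [starCovector_comp, h₃]⟩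
  map_add' τ τ' := by
    refine Subtype.ext (funext fun v => ?_)
    exact map_add (starCovector h) _ _
  map_smul' c τ := by
    refine Subtype.ext (funext fun v => ?_)
    exact map_smul (starCovector h) _ _

/-- Invariant forms of all degrees; there are none but `0` in degrees above `2`. -/
abbrev TotalForms : Type := (k : ℕ) → TransverseForm k

/-- The exterior derivative on forms of all degrees. -/
noncomputable def dTot : TotalForms →ₗ[ℝ] TotalForms :=
  LinearMap.pi fun k => match k with
    | 0 => 0
    | k + 1 => dT k ∘ₗ LinearMap.proj k

/-- The symplectic star on forms of all degrees, mapping degree `2 - l` to degree `l`. -/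
noncomputable def starTot : TotalForms →ₗ[ℝ] TotalForms :=
  LinearMap.pi fun l =>
    if h : l ≤ 2 then starT (Nat.sub_add_cancel h) ∘ₗ LinearMap.proj (2 - l) else 0

/-- Multiplication by `(-1) ^ (k + 1)` in degree `k`. -/
noncomputable def signTot : TotalForms →ₗ[ℝ] TotalForms :=
  LinearMap.pi fun k => (-1 : ℝ) ^ (k + 1) • LinearMap.proj k

/-- The operator `d^Λ α = (-1) ^ (k + 1) ⋆ d ⋆ α` for `α` of degree `k`. -/
noncomputable def dLambda : TotalForms →ₗ[ℝ] TotalForms :=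
  starTot ∘ₗ dTot ∘ₗ starTot ∘ₗ signTot

/-- The degree `k` part of a space of forms. -/
noncomputable def degreePart (S : Submodule ℝ TotalForms) (k : ℕ) : Submodule ℝ (TransverseForm k) :=
  S.comap (LinearMap.single ℝ TransverseForm k)

/-- The degree `k` part of the quotient `Z / B`. -/
abbrev Cohomology (Z B : Submodule ℝ TotalForms) (k : ℕ) : Type :=
  degreePart Z k ⧸ (degreePart B k).submoduleOf (degreePart Z k)

/-- Basic cohomology `ker d / im d`. -/
abbrev HBasic (k : ℕ) : Type := Cohomology (LinearMap.ker dTot) (LinearMap.range dTot) k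

/-- The cohomology `ker (d + d^Λ) / im (d d^Λ)`. -/
abbrev HSum (k : ℕ) : Type :=
  Cohomology (LinearMap.ker (dTot + dLambda)) (LinearMap.range (dTot ∘ₗ dLambda)) k

/-- The cohomology `ker (d d^Λ) / (im d + im d^Λ)`. -/
abbrev HProd (k : ℕ) : Type :=
  Cohomology (LinearMap.ker (dTot ∘ₗ dLambda)) (LinearMap.range dTot ⊔ LinearMap.range dLambda) k

end Sympl

/-! ### Smooth functions on the circle, coordinate forms, and the comparison with forms on `M` -/

/-- `C^∞(S¹)`. -/
abbrev SmoothCircle : Type := C^∞⟮𝓡 1, Circle; 𝓘(ℝ, ℝ), ℝ⟯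

/-- The point of the circle with coordinate `y ∈ ℝ/ℤ`. -/
noncomputable def circlePoint (y : ℝ) : Circle := Circle.exp (2 * Real.pi * y)

/-- The covector `dy`. -/
noncomputable def dy : Plane [⋀^Fin 1]→L[ℝ] ℝ :=
  ContinuousAlternatingMap.ofSubsingleton ℝ Plane ℝ 0 (ContinuousLinearMap.proj 1)

/-- A number as a covector of degree `0`. -/
noncomputable def scalar (c : ℝ) : Plane [⋀^Fin 0]→L[ℝ] ℝ :=
  ContinuousAlternatingMap.constOfIsEmpty ℝ Plane (Fin 0) c

/-- The form `α` on `M` corresponds to the form `τ` on the transversal: their pullbacks to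
`Space`, along the covering map and along the projection `(t, s) ↦ t`, agree. -/
def Corresponds {k : ℕ} (α : DiffForm Space M k) (τ : TransverseForm k) : Prop :=
  ∀ (p : Space) (w : Fin k → Space),
    α (proj p) (fun i => mfderiv 𝓘(ℝ, Space) 𝓘(ℝ, Space) proj p (w i)) =
      τ.1 p.1 (fun i => (w i).1)

end Suspension

namespace Suspension

/-! ### Smooth functions on the circle and periodic functions on the line -/

/-! A form on `M` pulls back to a deck-invariant form on `ℝ² × ℝ`. Being basic means that this
pullback has no `ds` component and, since `∂/∂s` also annihilates its differential, that it does not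
depend on `s`. It is therefore a form on the plane, and deck invariance becomes `ℤ²`-periodicity
together with `A`-invariance (`descendLin_surjective`).

Invariance under all powers of `A` is very restrictive, because `A ^ n` rotates the circle at height
`y` by `n y`. Heights arbitrarily close to `y` can be chosen where some power carries `x` to any
prescribed `x'` modulo `ℤ`, so by continuity an invariant function depends on `y` only
(`eq_of_invariant`). At heights where a power fixes the point, its derivative still shears `∂/∂y` by
a nonzero multiple of `∂/∂x`. This kills the `dx` coefficient of an invariant 1-form
(`transverseForm_one_apply_zero`). What remains is one function `f(y)` in each of the degrees 0, 1
and 2.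

On coefficients, `d f = f' dy` is the only nonzero component of `d`. The star exchanges `f` and `f
dx ∧ dy` and fixes 1-forms, so the only nonzero component of `d^Λ` is `f dx ∧ dy ↦ -f' dy`
(`dTot_apply`, `dLambda_apply`). Consequently `d d^Λ = 0`, and both operators have image `{f' dy}`.
All nine groups then follow from two facts about the derivative on the circle: its kernel consists
of the constants, and its image of the functions with integral zero (`mem_range_dT_zero_iff`). -/

theorem circlePoint_add_one (y : ℝ) : circlePoint (y + 1) = circlePoint y := by
  rw [circlePoint, mul_add, mul_one, Circle.exp_add_two_pi, circlePoint]

theorem circlePoint_add_intCast (y : ℝ) (n : ℤ) : circlePoint (y + n) = circlePoint y := by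
  have h : Function.Periodic circlePoint 1 := circlePoint_add_one
  simpa using h.int_mul n y

theorem circlePoint_arg (z : Circle) : circlePoint (Complex.arg z / (2 * Real.pi)) = z := by
  rw [circlePoint, mul_div_cancel₀ _ (by positivity), Circle.exp_arg]

theorem contDiff_comp_circlePoint (f : SmoothCircle) :
    ContDiff ℝ ∞ fun y => f (circlePoint y) := by
  have h : ContMDiff 𝓘(ℝ, ℝ) (𝓡 1) ∞ circlePoint :=
    contMDiff_circleExp.comp (contDiff_const.mul contDiff_id).contMDiff
  exact (f.contMDiff.comp h).contDiff

theorem contMDiff_circle_coe : ContMDiff (𝓡 1) 𝓘(ℝ, ℂ) ∞ fun z : Circle => (z : ℂ) :=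
  haveI : Fact (Module.finrank ℝ ℂ = 1 + 1) := ⟨Complex.finrank_real_complex⟩
  contMDiff_coe_sphere

theorem contDiffAt_arg {z : ℂ} (hz : z ∈ Complex.slitPlane) : ContDiffAt ℝ ∞ Complex.arg z := by
  have h : ContDiffAt ℝ ∞ (fun w => (Complex.log w).im) z :=
    Complex.imCLM.contDiff.contDiffAt.comp z ((Complex.contDiffAt_log hz).restrict_scalars ℝ)
  simpa only [Complex.log_im] using h

theorem eq_comp_arg_of_comp_circlePoint {f : Circle → ℝ} {g : ℝ → ℝ}
    (h : ∀ y, f (circlePoint y) = g y) (z : Circle) :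
    f z = g (Complex.arg z / (2 * Real.pi)) := by
  rw [← h, circlePoint_arg]

/-- A second branch of the coordinate on the circle: `arg` jumps on the negative real axis, so there
the angle is read off from `-z` and corrected by half a turn. -/
theorem eq_comp_arg_neg_of_comp_circlePoint {f : Circle → ℝ} {g : ℝ → ℝ}
    (h : ∀ y, f (circlePoint y) = g y) (z : Circle) :
    f z = g (Complex.arg (-z : ℂ) / (2 * Real.pi) + 1 / 2) := by
  rw [← h]
  congr 1
  ext
  have e : 2 * Real.pi * (Complex.arg (-z : ℂ) / (2 * Real.pi) + 1 / 2)
      = Complex.arg (-z : ℂ) + Real.pi := by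
    field_simp
  have hz := Complex.norm_mul_exp_arg_mul_I (-z : ℂ)
  rw [norm_neg, Circle.norm_coe, Complex.ofReal_one, one_mul] at hz
  rw [circlePoint, e, Circle.coe_exp, Complex.ofReal_add, add_mul, Complex.exp_add, hz,
    Complex.exp_pi_mul_I]
  ring

/-- A function on the circle is smooth if its lift to the line is. -/
theorem contMDiff_of_comp_circlePoint {f : Circle → ℝ} {g : ℝ → ℝ} (hg : ContDiff ℝ ∞ g)
    (h : ∀ y, f (circlePoint y) = g y) : ContMDiff (𝓡 1) 𝓘(ℝ, ℝ) ∞ f := by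
  intro z
  -- The two branches are smooth on two arcs that cover the circle.
  rcases Complex.mem_slitPlane_or_neg_mem_slitPlane (Circle.coe_ne_zero z) with hz | hz
  · have e : f = (fun w : ℂ => g (Complex.arg w / (2 * Real.pi))) ∘ fun z : Circle => (z : ℂ) :=
      funext (eq_comp_arg_of_comp_circlePoint h)
    rw [e]
    refine ContMDiffAt.comp z (ContDiffAt.contMDiffAt ?_) contMDiff_circle_coe.contMDiffAt
    exact hg.contDiffAt.comp _ ((contDiffAt_arg hz).div_const _)
  · have e : f = (fun w : ℂ => g (Complex.arg (-w) / (2 * Real.pi) + 1 / 2)) ∘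
        fun z : Circle => (z : ℂ) := funext (eq_comp_arg_neg_of_comp_circlePoint h)
    rw [e]
    refine ContMDiffAt.comp z (ContDiffAt.contMDiffAt ?_) contMDiff_circle_coe.contMDiffAt
    refine hg.contDiffAt.comp _ (((ContDiffAt.comp (z : ℂ) (contDiffAt_arg hz)
      contDiffAt_id.neg).div_const _).add contDiffAt_const)

/-- Smooth periodic functions on the line descend to the circle. -/
theorem exists_smoothCircle {g : ℝ → ℝ} (hg : ContDiff ℝ ∞ g) (hp : Function.Periodic g 1) :
    ∃ f : SmoothCircle, ∀ y, f (circlePoint y) = g y := by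
  have h : ∀ y, g (Complex.arg (circlePoint y) / (2 * Real.pi)) = g y := by
    intro y
    have e := circlePoint_arg (circlePoint y)
    rw [circlePoint, circlePoint, Circle.exp_eq_exp] at e
    obtain ⟨m, hm⟩ := e
    have hm' : Complex.arg (circlePoint y) / (2 * Real.pi) = y + m := by
      have : 2 * Real.pi ≠ 0 := by positivity
      apply mul_left_cancel₀ this
      rw [circlePoint, hm]
      ring
    rw [hm']
    simpa using hp.int_mul m y
  exact ⟨⟨fun z => g (Complex.arg z / (2 * Real.pi)), contMDiff_of_comp_circlePoint hg h⟩, h⟩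

theorem smoothCircle_ext {f f' : SmoothCircle}
    (h : ∀ y, f (circlePoint y) = f' (circlePoint y)) : f = f' := by
  ext z
  rw [← circlePoint_arg z]
  exact h _

/-- Every element of a finite-dimensional algebra is algebraic over `ℝ`. A polynomial that
annihilates `z ↦ Re z` would vanish on `[-1, 1]`, the set of values of this function. -/
theorem not_finiteDimensional_smoothCircle : ¬ FiniteDimensional ℝ SmoothCircle := by
  intro hfin
  let r : SmoothCircle := ⟨fun z => (z : ℂ).re,
    Complex.reCLM.contDiff.contMDiff.comp contMDiff_circle_coe⟩
  obtain ⟨p, hp, hr⟩ := Algebra.IsIntegral.isIntegral (R := ℝ) r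
  have hr' : Polynomial.aeval r p = 0 := hr
  have hroot : ∀ z : Circle, p.eval (z : ℂ).re = 0 := by
    intro z
    have h₁ := Polynomial.aeval_algHom_apply
      ((Pi.evalAlgHom ℝ (fun _ : Circle => ℝ) z).comp ContMDiffMap.coeFnAlgHom) r p
    rw [hr', map_zero, Polynomial.aeval_def] at h₁
    exact h₁
  refine hp.ne_zero (Polynomial.eq_zero_of_infinite_isRoot p ?_)
  refine (Set.Icc_infinite (show (-1 : ℝ) < 1 by norm_num)).mono fun x hx => ?_
  have := hroot (Circle.exp (Real.arccos x))
  rw [Circle.coe_exp, Complex.exp_ofReal_mul_I_re, Real.cos_arccos hx.1 hx.2] at this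
  exact this

/-! ### Forms invariant under the shear -/

theorem shear_zero : shear 0 = ContinuousLinearMap.id ℝ Plane := by
  ext v i
  fin_cases i <;> simp [shear_apply]

theorem comp_comp_covector {U V W : Type*} [NormedAddCommGroup U] [NormedSpace ℝ U]
    [NormedAddCommGroup V] [NormedSpace ℝ V] [NormedAddCommGroup W] [NormedSpace ℝ W] {k : ℕ}
    (γ : W [⋀^Fin k]→L[ℝ] ℝ) (f : V →L[ℝ] W) (g : U →L[ℝ] V) :
    γ.compContinuousLinearMap (f.comp g)
      = (γ.compContinuousLinearMap f).compContinuousLinearMap g := rfl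

theorem transverseForm_shear {k : ℕ} (τ : TransverseForm k) (j : ℤ) (t : Plane) :
    (τ.1 (shear j t)).compContinuousLinearMap (shear j) = τ.1 t := by
  have hstep : ∀ t, (τ.1 (shear 1 t)).compContinuousLinearMap (shear 1) = τ.1 t := by
    rw [shear_one]; exact τ.2.2.2
  have hadd : ∀ (i j : ℤ) (t : Plane), (τ.1 (shear (i + j) t)).compContinuousLinearMap
      (shear (i + j)) = ((τ.1 (shear i (shear j t))).compContinuousLinearMap
        (shear i)).compContinuousLinearMap (shear j) := by
    intro i j t
    have e : shear (i + j) = (shear i).comp (shear j) := by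
      ext1 v; exact shear_add i j v
    rw [e, comp_comp_covector, ContinuousLinearMap.comp_apply]
  induction j using Int.induction_on generalizing t with
  | zero =>
    rw [shear_zero, ContinuousLinearMap.id_apply]
    ext w
    simp only [ContinuousAlternatingMap.compContinuousLinearMap_apply]
    rfl
  | succ i ih => rw [add_comm, hadd, hstep, ih]
  | pred i ih =>
    -- In `A ^ (-i) = A · A ^ (-i - 1)` the outer factor is removed by one-step invariance, so no
    -- inverse has to be taken.
    have h := hadd 1 (-(i : ℤ) - 1) t
    rw [hstep, show 1 + (-(i : ℤ) - 1) = -i by ring, ih] at h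
    exact h.symm

theorem transverseForm_add_intCast {k : ℕ} (τ : TransverseForm k) (t : Plane) (m n : ℤ) :
    τ.1 (t + ![(m : ℝ), (n : ℝ)]) = τ.1 t := by
  rw [← τ.2.2.1 ![m, n] t]
  have : ![(m : ℝ), (n : ℝ)] = fun i => ((![m, n] i : ℤ) : ℝ) := by
    ext i
    fin_cases i <;> rfl
  rw [this]

/-- Every real number is a limit of numbers `(p + δ) / (n + 1)`, `p ∈ ℤ`, as `n → ∞`. -/
theorem exists_tendsto_shifted_fraction (y δ : ℝ) : ∃ (u : ℕ → ℝ) (p : ℕ → ℤ),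
    Filter.Tendsto u Filter.atTop (𝓝 y) ∧ ∀ n : ℕ, ((n : ℝ) + 1) * u n = p n + δ := by
  -- This is `(p + δ) / (n + 1)` with `p = ⌊(n + 1) y⌋`. It differs from `y` by at most `(|δ| + 1) /
  -- (n + 1)`.
  refine ⟨fun n => y + (δ - Int.fract (((n : ℝ) + 1) * y)) * (1 / ((n : ℝ) + 1)),
    fun n => ⌊((n : ℝ) + 1) * y⌋, ?_, fun n => ?_⟩
  · have h : Filter.Tendsto (fun n : ℕ => (δ - Int.fract (((n : ℝ) + 1) * y)) *
        (1 / ((n : ℝ) + 1))) Filter.atTop (𝓝 0) := by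
      refine squeeze_zero_norm (a := fun n : ℕ => (|δ| + 1) * (1 / ((n : ℝ) + 1))) (fun n => ?_) ?_
      · rw [norm_mul, Real.norm_eq_abs, Real.norm_eq_abs,
          abs_of_nonneg (show 0 ≤ 1 / ((n : ℝ) + 1) by positivity)]
        gcongr
        refine (abs_sub _ _).trans ?_
        gcongr
        rw [Int.abs_fract]
        exact (Int.fract_lt_one _).le
      · simpa using tendsto_one_div_add_atTop_nhds_zero_nat.const_mul (|δ| + 1)
    simpa using h.const_add y
  · have : (n : ℝ) + 1 ≠ 0 := by positivity
    simp only [← Int.self_sub_floor]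
    field_simp
    ring

theorem tendsto_vec_const {u : ℕ → ℝ} {y : ℝ} (x : ℝ)
    (h : Filter.Tendsto u Filter.atTop (𝓝 y)) :
    Filter.Tendsto (fun n => (![x, u n] : Plane)) Filter.atTop (𝓝 ![x, y]) := by
  rw [tendsto_pi_nhds]
  intro i
  fin_cases i
  · exact tendsto_const_nhds
  · exact h

/-- A continuous function on the torus that is invariant under the shear depends on `y` only. -/
theorem eq_of_invariant {g : Plane → ℝ} (hg : Continuous g)
    (hs : ∀ (j : ℤ) t, g (shear j t) = g t)
    (hp : ∀ (m n : ℤ) t, g (t + ![(m : ℝ), (n : ℝ)]) = g t) (x x' y : ℝ) :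
    g ![x, y] = g ![x', y] := by
  -- With this shift `x + (n + 1) u n = x' + p n`: the power `A ^ (n + 1)` takes `(x, u n)` to `(x',
  -- u n)` up to an integer translation.
  obtain ⟨u, p, hu, h⟩ := exists_tendsto_shifted_fraction y (x' - x)
  have e : ∀ n, g ![x, u n] = g ![x', u n] := by
    intro n
    rw [← hs (n + 1 : ℤ) ![x, u n], ← hp (p n) 0 ![x', u n]]
    congr 1
    ext i
    fin_cases i
    · have := h n
      simp [shear_apply]
      linarith
    · simp [shear_apply]
  refine tendsto_nhds_unique ((hg.tendsto _).comp (tendsto_vec_const x hu)) ?_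
  simp only [Function.comp_def, e]
  exact (hg.tendsto _).comp (tendsto_vec_const x' hu)

theorem transverseForm_continuous_apply {k : ℕ} (τ : TransverseForm k) (w : Fin k → Plane) :
    Continuous fun t => τ.1 t w :=
  (ContinuousAlternatingMap.apply ℝ Plane ℝ w).continuous.comp τ.2.1.continuous

/-- If `(n + 1) y` is an integer, `A ^ (n + 1)` fixes the point of the torus and maps `∂/∂y` to `(n
+ 1) ∂/∂x + ∂/∂y`. For `τ = a dx + b dy`, invariance then reads `(n + 1) a + b = b`, so `a = 0`
there. Such heights converge to any given one, and `a` is continuous. -/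
theorem transverseForm_one_apply_zero (τ : TransverseForm 1) (t : Plane) :
    τ.1 t ![stdBasis 0] = 0 := by
  have ht : t = ![t 0, t 1] := by ext i; fin_cases i <;> rfl
  rw [ht]
  obtain ⟨u, p, hu, h⟩ := exists_tendsto_shifted_fraction (t 1) 0
  have e : ∀ n, τ.1 ![t 0, u n] ![stdBasis 0] = 0 := by
    intro n
    have h₁ := DFunLike.congr_fun (transverseForm_shear τ (n + 1 : ℤ) ![t 0, u n]) ![stdBasis 1]
    have h₂ : shear (n + 1 : ℤ) ![t 0, u n] = ![t 0, u n] + ![(p n : ℝ), ((0 : ℤ) : ℝ)] := by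
      have := h n
      ext i
      fin_cases i
      · simp [shear_apply]
        linarith
      · simp [shear_apply]
    have h₃ : (shear (n + 1 : ℤ) ∘ ![stdBasis 1]) =
        Function.update ![stdBasis 1] 0 (((n : ℝ) + 1) • stdBasis 0 + stdBasis 1) := by
      ext i j
      fin_cases i
      fin_cases j <;> simp [shear_apply, stdBasis]
    have h₄ : ∀ z : Plane, Function.update ![stdBasis 1] 0 z = ![z] := by
      intro z
      ext i j
      fin_cases i
      rfl
    rw [h₂, transverseForm_add_intCast,
      ContinuousAlternatingMap.compContinuousLinearMap_apply, h₃,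
      ContinuousAlternatingMap.map_update_add, ContinuousAlternatingMap.map_update_smul, h₄, h₄,
      add_eq_right, smul_eq_mul, mul_eq_zero] at h₁
    exact h₁.resolve_left (by positivity)
  refine tendsto_nhds_unique (((transverseForm_continuous_apply τ _).tendsto _).comp
    (tendsto_vec_const (t 0) hu)) ?_
  simp only [Function.comp_def, e]
  exact tendsto_const_nhds

/-- The form `f(y) c` with a constant invariant covector `c`. -/
noncomputable def coeffForm {k : ℕ} (c : Plane [⋀^Fin k]→L[ℝ] ℝ)
    (hc : c.compContinuousLinearMap linA = c) : SmoothCircle →ₗ[ℝ] TransverseForm k where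
  toFun f := ⟨fun v => f (circlePoint (v 1)) • c, by
    refine ⟨?_, fun n v => ?_, fun v => ?_⟩
    · exact ((contDiff_comp_circlePoint f).comp (contDiff_apply ℝ ℝ 1)).smul contDiff_const
    · simp only [Pi.add_apply, circlePoint_add_intCast]
    · conv_rhs => rw [← hc]
      simp [linA_apply]
      rfl⟩
  map_add' f f' := by
    refine Subtype.ext (funext fun v => ?_)
    exact add_smul _ _ _
  map_smul' a f := by
    refine Subtype.ext (funext fun v => ?_)
    exact mul_smul _ _ _

theorem coeffForm_apply {k : ℕ} (c : Plane [⋀^Fin k]→L[ℝ] ℝ)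
    (hc : c.compContinuousLinearMap linA = c) (f : SmoothCircle) (v : Plane) :
    (coeffForm c hc f).1 v = f (circlePoint (v 1)) • c := rfl

/-- Since `c` is itself invariant, invariance of `τ = τ(u) c` passes to the scalar coefficient
`τ(u)`, which is then a function of `y` by `eq_of_invariant`. The tuple `u` serves only to read off
this coefficient. -/
theorem coeffForm_bijective {k : ℕ} {c : Plane [⋀^Fin k]→L[ℝ] ℝ}
    (hc : c.compContinuousLinearMap linA = c) {u : Fin k → Plane} (hu : c u = 1)
    (h : ∀ (τ : TransverseForm k) (v : Plane), τ.1 v = τ.1 v u • c) :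
    Function.Bijective (coeffForm c hc) := by
  constructor
  · intro f f' e
    refine smoothCircle_ext fun y => ?_
    have h₁ := DFunLike.congr_fun (congrFun (congrArg Subtype.val e) ![0, y]) u
    change f (circlePoint y) * c u = f' (circlePoint y) * c u at h₁
    rwa [hu, mul_one, mul_one] at h₁
  · intro τ
    have hsm : ContDiff ℝ ∞ fun t => τ.1 t u :=
      (ContinuousAlternatingMap.apply ℝ Plane ℝ u).contDiff.comp τ.2.1
    have hs : ∀ (j : ℤ) t, τ.1 (shear j t) u = τ.1 t u := by
      intro j t
      -- Invariance of `c` under all powers comes from applying `transverseForm_shear` to the form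
      -- with constant coefficient 1.
      have hc' : ∀ j : ℤ, c.compContinuousLinearMap (shear j) = c := by
        intro j
        obtain ⟨f, hf⟩ := exists_smoothCircle (g := fun _ => 1) contDiff_const fun _ => rfl
        have := transverseForm_shear (coeffForm c hc f) j 0
        simpa only [coeffForm_apply, hf, one_smul] using this
      have h₁ := DFunLike.congr_fun (transverseForm_shear τ j t) u
      rw [h τ (shear j t)] at h₁
      change τ.1 (shear j t) u * (c.compContinuousLinearMap (shear j)) u = _ at h₁
      rwa [hc', hu, mul_one] at h₁
    have hy := eq_of_invariant hsm.continuous hs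
      fun m n t => by rw [transverseForm_add_intCast]
    obtain ⟨f, hf⟩ := exists_smoothCircle (g := fun y => τ.1 ![0, y] u)
      (hsm.comp (contDiff_pi.2 fun i => by
        fin_cases i
        · exact contDiff_const
        · exact contDiff_id)) (fun y => by
          have := transverseForm_add_intCast τ ![0, y] 0 1
          simp only [Int.cast_zero, Int.cast_one, Matrix.cons_add_cons, add_zero,
            Matrix.empty_add_empty] at this
          simp only [this])
    refine ⟨f, Subtype.ext (funext fun v => ?_)⟩
    have hv : v = ![v 0, v 1] := by ext i; fin_cases i <;> rfl
    rw [coeffForm_apply, hf, h τ v]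
    conv_rhs => rw [hv]
    rw [hy]

theorem scalar_eq_smul (a : ℝ) : scalar a = a • scalar 1 := by
  ext v
  simp [scalar]

theorem dy_apply (w : Fin 1 → Plane) : dy w = w 0 1 := rfl

theorem areaForm_comp_linA : areaForm.compContinuousLinearMap linA = areaForm := by
  ext v
  change areaForm (fun i => linA (v i)) = areaForm v
  simp [areaForm_apply, linA_apply]
  ring

theorem dy_comp_linA : dy.compContinuousLinearMap linA = dy := by
  ext v
  change (linA (v 0)) 1 = v 0 1
  simp [linA_apply]

theorem one_form_apply (γ : Plane [⋀^Fin 1]→L[ℝ] ℝ) (w : Fin 1 → Plane) :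
    γ w = w 0 0 * γ ![stdBasis 0] + w 0 1 * γ ![stdBasis 1] := by
  have hw : w = Function.update w 0 (w 0 0 • stdBasis 0 + w 0 1 • stdBasis 1) := by
    ext i j
    fin_cases i
    fin_cases j <;> simp [stdBasis]
  have hz : ∀ z : Plane, Function.update w 0 z = ![z] := by
    intro z
    ext i j
    fin_cases i
    rfl
  conv_lhs => rw [hw]
  rw [ContinuousAlternatingMap.map_update_add, ContinuousAlternatingMap.map_update_smul,
    ContinuousAlternatingMap.map_update_smul, hz, hz, smul_eq_mul, smul_eq_mul]

/-- The functions on the leaf space are the functions `f(y)`. -/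
noncomputable def formEquivZero : SmoothCircle ≃ₗ[ℝ] TransverseForm 0 :=
  LinearEquiv.ofBijective (coeffForm (scalar 1) rfl) <|
    coeffForm_bijective (u := 0) rfl rfl fun τ v => by
      ext w
      rw [eq_const _ w 0]
      simp [scalar]

/-- The basic 1-forms are the forms `f(y) dy`. -/
noncomputable def formEquivOne : SmoothCircle ≃ₗ[ℝ] TransverseForm 1 :=
  LinearEquiv.ofBijective (coeffForm dy dy_comp_linA) <|
    coeffForm_bijective (u := ![stdBasis 1]) dy_comp_linA (by simp [dy_apply, stdBasis])
      fun τ v => by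
        ext w
        rw [one_form_apply, transverseForm_one_apply_zero, mul_zero, zero_add, mul_comm]
        rfl

/-- The basic 2-forms are the forms `f(y) dx ∧ dy`. -/
noncomputable def formEquivTwo : SmoothCircle ≃ₗ[ℝ] TransverseForm 2 :=
  LinearEquiv.ofBijective (coeffForm areaForm areaForm_comp_linA) <|
    coeffForm_bijective (u := stdBasis) areaForm_comp_linA (by simp [areaForm_apply, stdBasis])
      fun τ v => by
        ext w
        exact alt_two_apply _ _

theorem subsingleton_transverseForm {k : ℕ} (hk : 3 ≤ k) : Subsingleton (TransverseForm k) := by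
  have h : ∀ γ : Plane [⋀^Fin k]→L[ℝ] ℝ, γ = 0 := by
    intro γ
    ext v
    refine γ.toAlternatingMap.map_linearDependent v fun hv => ?_
    have := hv.fintype_card_le_finrank
    simp at this
    omega
  refine ⟨fun τ τ' => Subtype.ext (funext fun v => ?_)⟩
  rw [h (τ.1 v), h (τ'.1 v)]

/-! ### The covering map in charts -/

theorem chartAt_symm_eq_proj (x : M) : ((chartAt Space x).symm : Space → M) = proj :=
  symm_eq_proj (chart_mem_atlas Space x)

/-- The linear part of a deck transformation. -/
noncomputable def deckLin (k : ℤ) : Space →L[ℝ] Space :=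
  (shear k).prodMap (ContinuousLinearMap.id ℝ ℝ)

theorem deckLin_apply (k : ℤ) (w : Space) : deckLin k w = (shear k w.1, w.2) := rfl

theorem deckLin_zero : deckLin 0 = ContinuousLinearMap.id ℝ Space := by
  rw [deckLin, shear_zero]
  rfl

theorem hasFDerivAt_smul (g : Deck) (p : Space) :
    HasFDerivAt (fun w : Space => g • w) (deckLin g.k) p := by
  simp only [Deck.smul_def]
  refine HasFDerivAt.prodMk ?_ ?_
  · exact ((shear g.k).hasFDerivAt.comp p hasFDerivAt_fst).add_const _
  · exact hasFDerivAt_snd.add_const _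

/-- The lift of a point of `M` that its preferred chart selects. -/
noncomputable def basePoint (x : M) : Space := chartAt Space x x

theorem proj_basePoint (x : M) : proj (basePoint x) = x := by
  rw [← chartAt_symm_eq_proj x]
  exact (chartAt Space x).left_inv (mem_chart_source Space x)

/-- Inverse charts are given by `proj`, so a chart after `proj` is locally the deck transformation
that moves `p` into the target of the chart. -/
theorem chart_comp_proj_eventuallyEq {x : M} {p : Space} {g : Deck}
    (hg : g • p ∈ (chartAt Space x).target) :
    (fun w => chartAt Space x (proj w)) =ᶠ[𝓝 p] fun w => g • w := by
  have hcont : Continuous fun w : Space => g • w := continuous_const_smul g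
  filter_upwards [hcont.continuousAt.eventually_mem
    ((chartAt Space x).open_target.mem_nhds hg)] with w hw
  rw [← proj_smul g w, ← chartAt_symm_eq_proj x, (chartAt Space x).right_inv hw]

theorem contMDiff_proj : ContMDiff 𝓘(ℝ, Space) 𝓘(ℝ, Space) ∞ proj := by
  intro p
  obtain ⟨g, hg⟩ := exists_smul_of_proj_eq (proj_basePoint (proj p)).symm
  have ht : g • p ∈ (chartAt Space (proj p)).target := by
    rw [hg]
    exact mem_chart_target Space _
  have h₁ : ContMDiffAt 𝓘(ℝ, Space) 𝓘(ℝ, Space) ∞ (chartAt Space (proj p)).symm (g • p) :=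
    (contMDiffOn_chart_symm (n := ∞) (I := 𝓘(ℝ, Space)) (x := proj p)).contMDiffAt
      ((chartAt Space (proj p)).open_target.mem_nhds ht)
  rw [chartAt_symm_eq_proj] at h₁
  have h₂ : ContMDiffAt 𝓘(ℝ, Space) 𝓘(ℝ, Space) ∞ (fun w : Space => g • w) p := by
    refine ContDiffAt.contMDiffAt ?_
    simp only [Deck.smul_def]
    fun_prop
  have h₃ := h₁.comp p h₂
  have e : proj ∘ (fun w : Space => g • w) = proj := funext (proj_smul g)
  rwa [e] at h₃

/-- The tangent space of `M` at a point is identified with `Space` by the preferred chart there. The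
derivative of `proj` is thus not the identity in general: it is the linear part of the deck
transformation carrying `p` to the chosen lift. -/
theorem mfderiv_proj {p : Space} {g : Deck} (hg : g • p = basePoint (proj p)) :
    mfderiv 𝓘(ℝ, Space) 𝓘(ℝ, Space) proj p = deckLin g.k := by
  rw [((contMDiff_proj p).mdifferentiableAt (by simp)).mfderiv]
  have e : writtenInExtChartAt 𝓘(ℝ, Space) 𝓘(ℝ, Space) p proj
      = fun w => chartAt Space (proj p) (proj w) := by
    ext1 w
    rfl
  rw [e]
  simp only [extChartAt_model_space_eq_id, PartialEquiv.refl_coe, id_eq,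
    ModelWithCorners.range_eq_univ, fderivWithin_univ]
  have ht : g • p ∈ (chartAt Space (proj p)).target := by
    rw [hg]
    exact mem_chart_target Space _
  rw [(chart_comp_proj_eventuallyEq ht).fderiv_eq]
  exact (hasFDerivAt_smul g p).fderiv

theorem mfderiv_chart_self (x : M) :
    mfderiv 𝓘(ℝ, Space) 𝓘(ℝ, Space) (chartAt Space x) x = ContinuousLinearMap.id ℝ Space := by
  have h := mfderiv_chartAt_eq_tangentCoordChange (I := 𝓘(ℝ, Space)) (mem_chart_source Space x)
  rw [h]
  ext1 v
  exact tangentCoordChange_self (I := 𝓘(ℝ, Space)) (by simp)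

/-- The linear parts of all deck transformations fix `(0, 1)`, so the choice of lift does not affect
the leaf direction. -/
theorem leafTangent_eq (x : M) :
    leafTangent x = Submodule.span ℝ {((0, 1) : Space)} := by
  have key : ∀ t s, (mfderiv 𝓘(ℝ, ℝ) 𝓘(ℝ, Space) (leaf t) s (1 : ℝ) : Space) = (0, 1) := by
    intro t s
    obtain ⟨g, hg⟩ := exists_smul_of_proj_eq (proj_basePoint (proj (t, s))).symm
    have hd : HasFDerivAt (fun s : ℝ => ((t, s) : Space)) (ContinuousLinearMap.inr ℝ Plane ℝ) s :=
      hasFDerivAt_prodMk_right t s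
    have hm := ((contMDiff_proj (t, s)).mdifferentiableAt (by simp)).hasMFDerivAt.comp s
      hd.hasMFDerivAt
    rw [show leaf t = proj ∘ fun s => ((t, s) : Space) from rfl, hm.mfderiv, mfderiv_proj hg]
    change deckLin g.k (0, 1) = (0, 1)
    rw [deckLin_apply, map_zero]
  unfold leafTangent
  congr 1
  ext v
  constructor
  · rintro ⟨t, s, -, hv⟩
    exact hv.trans (key t s)
  · intro hv
    refine ⟨(basePoint x).1, (basePoint x).2, proj_basePoint x, ?_⟩
    exact Eq.trans hv (key _ _).symm

/-! ### Pullbacks to the universal cover -/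

/-- The pullback of a form on `M` to the universal cover. -/
noncomputable def coverForm {k : ℕ} (α : DiffForm Space M k) (p : Space) :
    Space [⋀^Fin k]→L[ℝ] ℝ :=
  (α (proj p)).compContinuousLinearMap (mfderiv 𝓘(ℝ, Space) 𝓘(ℝ, Space) proj p)

/-- The inverse of each preferred chart is `proj` as a total function, even off the target. All
charts therefore give one and the same form on the cover, where smoothness and `d` can be studied.
-/
theorem chartForm_eq_coverForm {k : ℕ} (α : DiffForm Space M k) (x : M) :
    chartForm α x = coverForm α := by
  funext z
  unfold chartForm coverForm
  rw [chartAt_symm_eq_proj]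

theorem coverForm_eq {k : ℕ} (α : DiffForm Space M k) {p : Space} {x : M} (hx : proj p = x)
    {g : Deck} (hg : g • p = basePoint x) :
    coverForm α p = ContinuousAlternatingMap.compContinuousLinearMap
      (show Space [⋀^Fin k]→L[ℝ] ℝ from α x) (deckLin g.k) := by
  subst hx
  unfold coverForm
  rw [mfderiv_proj hg]
  rfl

theorem coverForm_basePoint {k : ℕ} (α : DiffForm Space M k) (x : M) :
    coverForm α (basePoint x) = α x := by
  rw [coverForm_eq α (proj_basePoint x) (g := 1) (one_smul _ _), Deck.one_def, deckLin_zero]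
  rfl

/-- The points `p` and `g • p` have the same chosen lift, reached by `h` and `h * g⁻¹`, and linear
parts of deck transformations multiply. -/
theorem coverForm_smul {k : ℕ} (α : DiffForm Space M k) (g : Deck) (p : Space) :
    (coverForm α (g • p)).compContinuousLinearMap (deckLin g.k) = coverForm α p := by
  obtain ⟨h, hh⟩ := exists_smul_of_proj_eq (proj_basePoint (proj p)).symm
  have hh' : (h * g⁻¹) • (g • p) = basePoint (proj p) := by
    rw [mul_smul, inv_smul_smul, hh]
  rw [coverForm_eq α rfl hh, coverForm_eq α (proj_smul g p) hh']
  have e : deckLin h.k = (deckLin (h * g⁻¹).k).comp (deckLin g.k) := by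
    have hk : h.k = (h * g⁻¹).k + g.k := by
      have := congrArg Deck.k (inv_mul_cancel_right h g)
      exact this.symm
    refine ContinuousLinearMap.ext fun w => ?_
    rw [ContinuousLinearMap.comp_apply]
    simp only [deckLin_apply]
    rw [← shear_add, ← hk]
  rw [e, comp_comp_covector]

theorem extDerivForm_eq {k : ℕ} (α : DiffForm Space M k) (x : M) :
    extDerivForm α x = extDeriv (coverForm α) (basePoint x) := by
  unfold extDerivForm
  rw [chartForm_eq_coverForm, mfderiv_chart_self]
  rfl

/-- Smoothness is given on chart targets only. A deck transformation moves any point into one, and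
`coverForm_smul` carries smoothness back. -/
theorem IsSmoothForm.contDiff_coverForm {k : ℕ} {α : DiffForm Space M k} (h : IsSmoothForm α) :
    ContDiff ℝ ∞ (coverForm α) := by
  rw [contDiff_iff_contDiffAt]
  intro p
  obtain ⟨g, hg⟩ := exists_smul_of_proj_eq (proj_basePoint (proj p)).symm
  have h₁ : ContDiffAt ℝ ∞ (coverForm α) (g • p) := by
    have := h (proj p)
    rw [chartForm_eq_coverForm] at this
    refine this.contDiffAt ((chartAt Space (proj p)).open_target.mem_nhds ?_)
    rw [hg]
    exact mem_chart_target Space _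
  have h₂ : ContDiffAt ℝ ∞ (fun w : Space => g • w) p := by
    simp only [Deck.smul_def]
    fun_prop
  have h₃ := (ContinuousAlternatingMap.compContinuousLinearMapCLM (ι := Fin k) (F := ℝ)
    (deckLin g.k)).contDiff.contDiffAt.comp p (h₁.comp p h₂)
  refine h₃.congr_of_eventuallyEq (Filter.Eventually.of_forall fun w => ?_)
  exact (coverForm_smul α g w).symm

theorem apply_eq_zero_of_fst_eq_zero {k : ℕ} {γ : Space [⋀^Fin k]→L[ℝ] ℝ}
    (h : ∀ (w : Fin k → Space) (i : Fin k), w i = (0, 1) → γ w = 0)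
    {w : Fin k → Space} {i : Fin k} (hw : (w i).1 = 0) : γ w = 0 := by
  have e : w = Function.update w i ((w i).2 • ((0, 1) : Space)) := by
    have : (w i).2 • ((0, 1) : Space) = w i := by
      ext1
      · simp [hw]
      · simp
    rw [this, Function.update_eq_self]
  rw [e, ContinuousAlternatingMap.map_update_smul, h _ i (by simp), smul_zero]

/-- Expand multilinearly after splitting each vector into its plane and vertical parts: every term
with a vertical entry vanishes. -/
theorem apply_eq_apply_fst {k : ℕ} {γ : Space [⋀^Fin k]→L[ℝ] ℝ}
    (h : ∀ (w : Fin k → Space) (i : Fin k), w i = (0, 1) → γ w = 0) (w : Fin k → Space) :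
    γ w = γ fun i => ((w i).1, 0) := by
  have e : w = (fun i => (((w i).1, 0) : Space)) + fun i => (((0, (w i).2)) : Space) := by
    ext1 i
    simp
  have hs := γ.toMultilinearMap.map_add_univ (fun i => (((w i).1, 0) : Space))
    (fun i => (((0, (w i).2)) : Space))
  rw [← e, Finset.sum_eq_single Finset.univ] at hs
  · simpa using hs
  · intro s _ hne
    obtain ⟨i, hi⟩ : ∃ i, i ∉ s := by
      by_contra! hcon
      exact hne (Finset.eq_univ_of_forall hcon)
    refine apply_eq_zero_of_fst_eq_zero h (i := i) ?_
    simp [Finset.piecewise, hi]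
  · intro hcon
    exact absurd (Finset.mem_univ _) hcon

theorem annihilates_span_iff {k : ℕ} (γ : Space [⋀^Fin k]→L[ℝ] ℝ) :
    Annihilates (Submodule.span ℝ {((0, 1) : Space)}) γ ↔
      ∀ (w : Fin k → Space) (i : Fin k), w i = (0, 1) → γ w = 0 := by
  constructor
  · intro h w i hw
    exact h w ⟨i, Submodule.mem_span_singleton.2 ⟨1, by rw [one_smul]; exact hw.symm⟩⟩
  · rintro h w ⟨i, hi⟩
    obtain ⟨c, hc⟩ := Submodule.mem_span_singleton.1 hi
    exact apply_eq_zero_of_fst_eq_zero h (i := i) (by rw [← hc]; simp)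

theorem annihilates_leafTangent_iff {k : ℕ} {x : M} (γ : Space [⋀^Fin k]→L[ℝ] ℝ) :
    Annihilates (V := TangentSpace 𝓘(ℝ, Space) x) (leafTangent x) γ ↔
      ∀ (w : Fin k → Space) (i : Fin k), w i = (0, 1) → γ w = 0 := by
  rw [leafTangent_eq]
  exact annihilates_span_iff γ

/-! ### Forms on the universal cover that come from the transversal -/

/-- The pullback of a form on the plane under `(t, s) ↦ t`. -/
noncomputable def prForm {k : ℕ} (τ : Plane → Plane [⋀^Fin k]→L[ℝ] ℝ) (p : Space) :
    Space [⋀^Fin k]→L[ℝ] ℝ :=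
  (τ p.1).compContinuousLinearMap (ContinuousLinearMap.fst ℝ Plane ℝ)

theorem contDiff_prForm {k : ℕ} {τ : Plane → Plane [⋀^Fin k]→L[ℝ] ℝ} (h : ContDiff ℝ ∞ τ) :
    ContDiff ℝ ∞ (prForm τ) :=
  (ContinuousAlternatingMap.compContinuousLinearMapCLM (ι := Fin k) (F := ℝ)
    (ContinuousLinearMap.fst ℝ Plane ℝ)).contDiff.comp (h.comp contDiff_fst)

theorem extDeriv_prForm {k : ℕ} {τ : Plane → Plane [⋀^Fin k]→L[ℝ] ℝ} (h : ContDiff ℝ ∞ τ)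
    (p : Space) : extDeriv (prForm τ) p = prForm (extDeriv τ) p := by
  have h := extDeriv_pullback (f := (Prod.fst : Space → Plane)) (x := p) (r := ∞)
    ((h.differentiable (by simp)) p.1) contDiff_fst.contDiffAt
    (by simp; exact WithTop.coe_le_coe.2 le_top)
  simp only [fderiv_fst] at h
  exact h

theorem prForm_apply_eq_zero {k : ℕ} (τ : Plane → Plane [⋀^Fin k]→L[ℝ] ℝ) (p : Space)
    (w : Fin k → Space) (i : Fin k) (hw : w i = (0, 1)) : prForm τ p w = 0 := by
  change τ p.1 (fun j => (w j).1) = 0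
  exact (τ p.1).map_coord_zero i (by rw [hw])

/-- A form that is annihilated by `∂/∂s` and whose differential is annihilated by `∂/∂s` does not
depend on `s`. -/
theorem eq_of_annihilated {k : ℕ} {β : Space → Space [⋀^Fin k]→L[ℝ] ℝ} (hβ : ContDiff ℝ ∞ β)
    (h₀ : ∀ p w (i : Fin k), w i = ((0, 1) : Space) → β p w = 0)
    (h₁ : ∀ p w (i : Fin (k + 1)), w i = ((0, 1) : Space) → extDeriv β p w = 0)
    (t : Plane) (s : ℝ) : β (t, s) = β (t, 0) := by
  have hd : Differentiable ℝ β := hβ.differentiable (by simp)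
  have key : ∀ p w, fderiv ℝ (fun q => β q w) p (0, 1) = 0 := by
    intro p w
    -- In the formula for `dβ(∂/∂s, w)` the first summand is the derivative of `β(w)` along `∂/∂s`.
    -- In every other summand `∂/∂s` stays among the arguments of `β`, which makes it zero.
    have h := h₁ p (Fin.cons ((0, 1) : Space) w : Fin (k + 1) → Space) 0 rfl
    rw [extDeriv_apply (hd p), Fin.sum_univ_succ, Finset.sum_eq_zero, add_zero] at h
    · simpa using h
    · intro i _
      have e : (fun q => β q (i.succ.removeNth (Fin.cons ((0, 1) : Space) w :
          Fin (k + 1) → Space))) = fun _ => 0 := by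
        funext q
        -- A further summand exists only when `k > 0`, so there is a slot 0 to hold `∂/∂s`.
        obtain ⟨k, rfl⟩ : ∃ l, k = l + 1 := ⟨k - 1, by have := i.2; omega⟩
        refine h₀ q _ 0 ?_
        simp [Fin.removeNth]
      rw [e]
      simp
  ext w
  have hder : ∀ r : ℝ, HasDerivAt (fun r => β (t, r) w) 0 r := by
    intro r
    have ha : DifferentiableAt ℝ (fun q => β q w) (t, r) :=
      (ContinuousAlternatingMap.apply ℝ Space ℝ w).differentiableAt.comp _ (hd _)
    have hl : HasDerivAt (fun r : ℝ => ((t, r) : Space)) (0, 1) r :=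
      (hasDerivAt_const r t).prodMk (hasDerivAt_id r)
    have := ha.hasFDerivAt.comp_hasDerivAt r hl
    rwa [key] at this
  exact is_const_of_deriv_eq_zero (fun r => (hder r).differentiableAt) (fun r => (hder r).deriv) s 0

/-! ### Basic forms are invariant forms on the transversal -/

theorem prForm_smul {k : ℕ} (τ : TransverseForm k) (g : Deck) (p : Space) :
    (prForm τ.1 (g • p)).compContinuousLinearMap (deckLin g.k) = prForm τ.1 p := by
  unfold prForm
  rw [Deck.smul_def, transverseForm_add_intCast, ← transverseForm_shear τ g.k p.1]
  rfl

/-- The form on `M` that an invariant form on the transversal induces. -/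
noncomputable def descend {k : ℕ} (τ : TransverseForm k) : DiffForm Space M k :=
  fun x => prForm τ.1 (basePoint x)

/-- The lift chosen in `descend` is immaterial because `prForm τ.1` is deck-invariant. -/
theorem coverForm_descend {k : ℕ} (τ : TransverseForm k) :
    coverForm (descend τ) = prForm τ.1 := by
  funext p
  obtain ⟨g, hg⟩ := exists_smul_of_proj_eq (proj_basePoint (proj p)).symm
  rw [coverForm_eq _ rfl hg, ← prForm_smul τ g p, hg]
  rfl

theorem extDerivForm_descend {k : ℕ} (τ : TransverseForm k) :
    extDerivForm (descend τ) = descend (dT k τ) := by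
  funext x
  rw [extDerivForm_eq, coverForm_descend, extDeriv_prForm τ.2.1]
  rfl

theorem descend_mem_basicForms {k : ℕ} (τ : TransverseForm k) :
    descend τ ∈ basicForms leafTangent k := by
  refine ⟨fun x => ?_, fun x => ⟨?_, ?_⟩⟩
  · rw [chartForm_eq_coverForm, coverForm_descend]
    exact (contDiff_prForm τ.2.1).contDiffOn
  · exact (annihilates_leafTangent_iff _).2 (prForm_apply_eq_zero _ _)
  · rw [extDerivForm_descend]
    exact (annihilates_leafTangent_iff _).2 (prForm_apply_eq_zero _ _)

/-- The map from invariant forms on the transversal to basic forms. -/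
noncomputable def descendLin (k : ℕ) : TransverseForm k →ₗ[ℝ] basicForms leafTangent k where
  toFun τ := ⟨descend τ, descend_mem_basicForms τ⟩
  map_add' _ _ := rfl
  map_smul' _ _ := rfl

theorem descendLin_injective (k : ℕ) : Function.Injective (descendLin k) := by
  intro τ τ' h
  have h₁ : prForm τ.1 = prForm τ'.1 := by
    rw [← coverForm_descend, ← coverForm_descend]
    exact congrArg (fun a : basicForms leafTangent k => coverForm a.1) h
  refine Subtype.ext (funext fun t => ?_)
  ext w
  exact DFunLike.congr_fun (congrFun h₁ (t, 0)) fun i => (w i, 0)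

/-- The pullback of a basic form does not depend on `s`, so it is recovered from its restriction to
the slice `s = 0`. Deck elements with `k = 0` give periodicity of that restriction, and `(0, 0, 1)`
gives invariance under `A`. -/
theorem descendLin_surjective (k : ℕ) : Function.Surjective (descendLin k) := by
  rintro ⟨α, hα, hb⟩
  have hsm := hα.contDiff_coverForm
  have h₀ : ∀ p w (i : Fin k), w i = ((0, 1) : Space) → coverForm α p w = 0 := by
    intro p w i hw
    obtain ⟨g, hg⟩ := exists_smul_of_proj_eq (proj_basePoint (proj p)).symm
    rw [coverForm_eq α rfl hg]
    refine (annihilates_leafTangent_iff _).1 (hb (proj p)).1 _ i ?_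
    simp [hw, deckLin_apply]
  have h₁ : ∀ p w (i : Fin (k + 1)), w i = ((0, 1) : Space) → extDeriv (coverForm α) p w = 0 := by
    intro p w i hw
    obtain ⟨g, hg⟩ := exists_smul_of_proj_eq (proj_basePoint (proj p)).symm
    -- The hypothesis on `dα` speaks of chosen lifts only; naturality of `d` under deck
    -- transformations extends it to every `p`.
    have hpull := extDeriv_pullback (f := fun q : Space => g • q) (x := p) (r := ∞)
      (show DifferentiableAt ℝ (coverForm α) (g • p) from (hsm.differentiable (by simp)) _)
      (by simp only [Deck.smul_def]; fun_prop) (by simp; exact WithTop.coe_le_coe.2 le_top)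
    simp only [(hasFDerivAt_smul g _).fderiv, coverForm_smul] at hpull
    rw [hpull, hg]
    have := (hb (proj p)).2
    rw [extDerivForm_eq] at this
    refine (annihilates_leafTangent_iff _).1 this _ i ?_
    simp [hw, deckLin_apply]
  have hs := eq_of_annihilated hsm h₀ h₁
  let τ : Plane → Plane [⋀^Fin k]→L[ℝ] ℝ := fun t =>
    (coverForm α (t, 0)).compContinuousLinearMap (ContinuousLinearMap.inl ℝ Plane ℝ)
  have hdeck : ∀ (g : Deck) (t : Plane),
      (τ (shear g.k t + ![(g.m : ℝ), (g.n : ℝ)])).compContinuousLinearMap (shear g.k) = τ t := by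
    intro g t
    have e := coverForm_smul α g (t, 0)
    -- The deck element moves the slice `s = 0` to `s = g.k`; independence of `s` brings it back.
    rw [Deck.smul_def, hs] at e
    change _ = (coverForm α (t, 0)).compContinuousLinearMap _
    rw [← e]
    ext w
    change coverForm α _ (fun i => (shear g.k (w i), (0 : ℝ))) =
      coverForm α _ (fun i => deckLin g.k (w i, 0))
    rfl
  have hτ : τ ∈ transverseForms k := by
    refine ⟨?_, fun n v => ?_, fun v => ?_⟩
    · exact (ContinuousAlternatingMap.compContinuousLinearMapCLM (ι := Fin k) (F := ℝ)
        (ContinuousLinearMap.inl ℝ Plane ℝ)).contDiff.comp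
        (hsm.comp (contDiff_id.prodMk contDiff_const))
    · have := hdeck ⟨n 0, n 1, 0⟩ v
      rw [shear_zero] at this
      rw [← this]
      have e : (fun i => (n i : ℝ)) = ![(n 0 : ℝ), (n 1 : ℝ)] := by
        ext i; fin_cases i <;> rfl
      rw [e]
      rfl
    · have := hdeck ⟨0, 0, 1⟩ v
      rw [shear_one] at this
      rw [← this]
      have e : linA v + ![((0 : ℤ) : ℝ), ((0 : ℤ) : ℝ)] = linA v := by
        ext i; fin_cases i <;> simp
      rw [e]
  refine ⟨⟨τ, hτ⟩, Subtype.ext (funext fun x => ?_)⟩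
  change prForm τ (basePoint x) = α x
  rw [← coverForm_basePoint α x]
  generalize basePoint x = p
  obtain ⟨t, s⟩ := p
  rw [hs]
  ext w
  exact (apply_eq_apply_fst (h₀ (t, 0)) w).symm

/-- Basic forms are the invariant forms on the transversal. -/
noncomputable def basicEquiv (k : ℕ) : basicForms leafTangent k ≃ₗ[ℝ] TransverseForm k :=
  (LinearEquiv.ofBijective (descendLin k)
    ⟨descendLin_injective k, descendLin_surjective k⟩).symm

theorem descendLin_basicEquiv {k : ℕ} (α : basicForms leafTangent k) :
    descendLin k (basicEquiv k α) = α :=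
  LinearEquiv.apply_symm_apply (LinearEquiv.ofBijective (descendLin k) _) α

theorem basicEquiv_descendLin {k : ℕ} (τ : TransverseForm k) :
    basicEquiv k (descendLin k τ) = τ :=
  LinearEquiv.symm_apply_apply (LinearEquiv.ofBijective (descendLin k) _) τ

theorem corresponds_basicEquiv {k : ℕ} (α : basicForms leafTangent k) :
    Corresponds α.1 (basicEquiv k α) := by
  intro p w
  have h : coverForm α.1 = prForm (basicEquiv k α).1 := by
    rw [← coverForm_descend]
    exact congrArg (fun a : basicForms leafTangent k => coverForm a.1)
      (descendLin_basicEquiv α).symm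
  exact DFunLike.congr_fun (congrFun h p) w

theorem basicEquiv_extDerivForm {k : ℕ} (α : basicForms leafTangent k) :
    ∃ β : basicForms leafTangent (k + 1),
      β.1 = extDerivForm α.1 ∧ basicEquiv (k + 1) β = dT k (basicEquiv k α) := by
  refine ⟨descendLin (k + 1) (dT k (basicEquiv k α)), ?_, basicEquiv_descendLin _⟩
  conv_rhs => rw [← descendLin_basicEquiv α]
  exact (extDerivForm_descend _).symm

/-! ### The exterior derivative and the star in terms of coefficients -/

theorem formEquivZero_apply (f : SmoothCircle) (v : Plane) :
    (formEquivZero f).1 v = scalar (f (circlePoint (v 1))) :=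
  (scalar_eq_smul _).symm

theorem formEquivOne_apply (f : SmoothCircle) (v : Plane) :
    (formEquivOne f).1 v = f (circlePoint (v 1)) • dy := rfl

theorem formEquivTwo_apply (f : SmoothCircle) (v : Plane) :
    (formEquivTwo f).1 v = f (circlePoint (v 1)) • areaForm := rfl

theorem hasDerivAt_comp_circlePoint (f : SmoothCircle) (y : ℝ) :
    HasDerivAt (fun y => f (circlePoint y)) (deriv (fun y => f (circlePoint y)) y) y :=
  ((contDiff_comp_circlePoint f).differentiable (by simp) y).hasDerivAt

theorem hasFDerivAt_coeff (f : SmoothCircle) (v : Plane) :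
    HasFDerivAt (fun v : Plane => f (circlePoint (v 1)))
      (deriv (fun y => f (circlePoint y)) (v 1) •
        (ContinuousLinearMap.proj 1 : Plane →L[ℝ] ℝ)) v :=
  HasDerivAt.comp_hasFDerivAt (f := fun v : Plane => v 1) v
    (hasDerivAt_comp_circlePoint f (v 1))
    (ContinuousLinearMap.proj 1 : Plane →L[ℝ] ℝ).hasFDerivAt

theorem dT_formEquivZero_apply (f : SmoothCircle) (v : Plane) :
    (dT 0 (formEquivZero f)).1 v = deriv (fun y => f (circlePoint y)) (v 1) • dy := by
  change extDeriv (formEquivZero f).1 v = _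
  have e : (formEquivZero f).1 = fun v => ContinuousAlternatingMap.constOfIsEmpty ℝ Plane (Fin 0)
      (f (circlePoint (v 1))) := funext (formEquivZero_apply f)
  rw [e, extDeriv_constOfIsEmpty, (hasFDerivAt_coeff f v).fderiv]
  rfl

theorem formEquivOne_symm_dT (f : SmoothCircle) (y : ℝ) :
    formEquivOne.symm (dT 0 (formEquivZero f)) (circlePoint y)
      = deriv (fun y => f (circlePoint y)) y := by
  obtain ⟨g, hg⟩ := formEquivOne.surjective (dT 0 (formEquivZero f))
  have h := DFunLike.congr_fun (dT_formEquivZero_apply f ![0, y]) ![stdBasis 1]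
  rw [← hg, formEquivOne_apply] at h
  rw [← hg, LinearEquiv.symm_apply_apply]
  simpa [dy_apply, stdBasis] using h

/-- The differential of `f(y) dy` is `f' dy ∧ dy = 0`. -/
theorem dT_one : dT 1 = 0 := by
  ext1 τ
  obtain ⟨f, rfl⟩ := formEquivOne.surjective τ
  refine Subtype.ext (funext fun v => ?_)
  change extDeriv (formEquivOne f).1 v = 0
  ext w
  rw [extDeriv_apply ((formEquivOne f).2.1.differentiable (by simp) v)]
  have h : ∀ u : Fin 1 → Plane, fderiv ℝ (fun v => (formEquivOne f).1 v u) v =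
      u 0 1 • deriv (fun y => f (circlePoint y)) (v 1) •
        (ContinuousLinearMap.proj 1 : Plane →L[ℝ] ℝ) := by
    intro u
    have := (hasFDerivAt_coeff f v).mul_const (u 0 1)
    exact this.fderiv
  rw [Fin.sum_univ_two, h, h]
  simp [Fin.removeNth]
  ring

theorem starT_one_one (h : 1 + 1 = 2) (τ : TransverseForm 1) : starT h τ = τ :=
  Subtype.ext (funext fun v => (isStar_one_iff _ _).1 (isStar_starCovector h (τ.1 v)))

theorem starT_two_zero (h : 2 + 0 = 2) (f : SmoothCircle) :
    starT h (formEquivTwo f) = formEquivZero f := by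
  refine Subtype.ext (funext fun v => ?_)
  refine ((isStar_two_iff _ _).1 (isStar_starCovector h ((formEquivTwo f).1 v))).trans ?_
  rw [formEquivTwo_apply, formEquivZero_apply]
  simp [areaForm_apply, stdBasis, scalar]

/-! ### The operators on forms of all degrees -/

theorem dTot_apply (T : TotalForms) : dTot T = Pi.single 1 (dT 0 (T 0)) := by
  funext k
  match k with
  | 0 => rfl
  | 1 => rfl
  | 2 => exact LinearMap.congr_fun dT_one (T 1)
  | k + 3 => exact (subsingleton_transverseForm (by omega)).elim _ _

theorem starTot_zero (T : TotalForms) : starTot T 0 = starT rfl (T 2) := rfl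

theorem starTot_one (T : TotalForms) : starTot T 1 = starT rfl (T 1) := rfl

theorem starTot_two (T : TotalForms) : starTot T 2 = starT rfl (T 0) := rfl

/-- In degrees 0 and 1 the inner star lands in degrees 2 and 1, where `d` vanishes. In degree 2 it
turns `f dx ∧ dy` into `f`, the outer star fixes `f' dy`, and the sign is `(-1) ^ 3`. -/
theorem dLambda_apply (T : TotalForms) :
    dLambda T = Pi.single 1 (-dT 0 (formEquivZero (formEquivTwo.symm (T 2)))) := by
  have h : dLambda T = starTot (Pi.single 1 (dT 0 (starTot (signTot T) 0))) := by
    rw [← dTot_apply]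
    rfl
  obtain ⟨f, hf⟩ := formEquivTwo.surjective (T 2)
  have h₀ : starTot (signTot T) 0 = -formEquivZero (formEquivTwo.symm (T 2)) := by
    have hs : signTot T 2 = -T 2 := by
      change (-1 : ℝ) ^ 3 • T 2 = -T 2
      norm_num
    rw [starTot_zero, hs, map_neg, ← hf, starT_two_zero, LinearEquiv.symm_apply_apply]
  rw [h, h₀, map_neg]
  funext k
  match k with
  | 0 => rw [starTot_zero, Pi.single_eq_of_ne (by decide), map_zero, Pi.single_eq_of_ne (by decide)]
  | 1 => rw [starTot_one, Pi.single_eq_same, starT_one_one]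
  | 2 => rw [starTot_two, Pi.single_eq_of_ne (by decide), map_zero, Pi.single_eq_of_ne (by decide)]
  | k + 3 => exact (subsingleton_transverseForm (by omega)).elim _ _

/-- The image of `d^Λ` lies in degree 1, whose forms are closed. Hence nothing is divided out in
`HSum`, and every form is a cocycle for `HProd`. -/
theorem dTot_comp_dLambda : dTot ∘ₗ dLambda = 0 := by
  refine LinearMap.ext fun T => ?_
  rw [LinearMap.comp_apply, dLambda_apply, dTot_apply, Pi.single_eq_of_ne (by decide), map_zero,
    Pi.single_zero]
  rfl

theorem range_dTot : LinearMap.range dTot =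
    (LinearMap.range (dT 0)).map (LinearMap.single ℝ TransverseForm 1) := by
  ext T
  constructor
  · rintro ⟨S, rfl⟩
    exact ⟨_, ⟨S 0, rfl⟩, (dTot_apply S).symm⟩
  · rintro ⟨_, ⟨σ, rfl⟩, rfl⟩
    refine ⟨Pi.single 0 σ, ?_⟩
    rw [dTot_apply, Pi.single_eq_same]
    rfl

/-- Because `-f' dy = d(-f)`, the denominator of `HProd` is just the image of `d`. -/
theorem range_dLambda_le : LinearMap.range dLambda ≤ LinearMap.range dTot := by
  rintro _ ⟨S, rfl⟩
  rw [range_dTot, dLambda_apply, ← map_neg]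
  exact ⟨_, ⟨_, rfl⟩, rfl⟩

theorem mem_degreePart_range_dTot_one (τ : TransverseForm 1) :
    τ ∈ degreePart (LinearMap.range dTot) 1 ↔ τ ∈ LinearMap.range (dT 0) := by
  rw [range_dTot]
  exact (Pi.single_injective 1).mem_set_image

theorem mem_degreePart_range_dTot {k : ℕ} (hk : k ≠ 1) (τ : TransverseForm k) :
    τ ∈ degreePart (LinearMap.range dTot) k ↔ τ = 0 := by
  constructor
  · rintro ⟨S, hS⟩
    have h := congrFun hS k
    rw [dTot_apply, Pi.single_eq_of_ne hk] at h
    rw [h]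
    exact (Pi.single_eq_same k τ).symm
  · rintro rfl
    exact Submodule.zero_mem _

theorem mem_degreePart_ker_dTot_zero (τ : TransverseForm 0) :
    τ ∈ degreePart (LinearMap.ker dTot) 0 ↔ dT 0 τ = 0 := by
  change dTot (Pi.single 0 τ) = 0 ↔ _
  rw [dTot_apply, Pi.single_eq_same, Pi.single_eq_zero_iff]

theorem degreePart_ker_dTot {k : ℕ} (hk : k ≠ 0) (τ : TransverseForm k) :
    τ ∈ degreePart (LinearMap.ker dTot) k := by
  change dTot (Pi.single k τ) = 0
  rw [dTot_apply, Pi.single_eq_of_ne hk.symm, map_zero, Pi.single_zero]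

/-- Both operators land in degree 1, so the kernel is cut out by the single equation `f₀' = f₂'`
between the coefficients in degrees 0 and 2. It also contains mixed elements such as `f + f dx ∧
dy`; on a homogeneous form at least one side is zero. -/
theorem mem_degreePart_ker_dTot_add_dLambda {k : ℕ} (τ : TransverseForm k) :
    τ ∈ degreePart (LinearMap.ker (dTot + dLambda)) k ↔
      dT 0 ((Pi.single k τ : TotalForms) 0) =
        dT 0 (formEquivZero (formEquivTwo.symm ((Pi.single k τ : TotalForms) 2))) := by
  change dTot (Pi.single k τ) + dLambda (Pi.single k τ) = 0 ↔ _
  rw [dTot_apply, dLambda_apply, ← Pi.single_add, Pi.single_eq_zero_iff, ← sub_eq_add_neg,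
    sub_eq_zero]

/-! ### Closed and exact forms -/

theorem dT_formEquivZero_eq_zero_iff (f : SmoothCircle) :
    dT 0 (formEquivZero f) = 0 ↔ ∀ c c', f c = f c' := by
  have h : dT 0 (formEquivZero f) = 0 ↔ ∀ y, deriv (fun y => f (circlePoint y)) y = 0 := by
    rw [← formEquivOne.symm.map_eq_zero_iff]
    constructor
    · intro e y
      rw [← formEquivOne_symm_dT, e]
      rfl
    · intro e
      refine smoothCircle_ext fun y => ?_
      rw [formEquivOne_symm_dT, e]
      rfl
  rw [h]
  constructor
  · intro e c c'
    rw [← circlePoint_arg c, ← circlePoint_arg c']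
    exact is_const_of_deriv_eq_zero
      ((contDiff_comp_circlePoint f).differentiable (by simp)) e _ _
  · intro e y
    have : (fun y => f (circlePoint y)) = fun _ => f 1 := funext fun y => e _ _
    rw [this, deriv_const]

/-- Integration over the circle. -/
noncomputable def circleIntegralLin : SmoothCircle →ₗ[ℝ] ℝ where
  toFun f := ∫ y in (0 : ℝ)..1, f (circlePoint y)
  map_add' f f' := intervalIntegral.integral_add
    ((contDiff_comp_circlePoint f).continuous.intervalIntegrable _ _)
    ((contDiff_comp_circlePoint f').continuous.intervalIntegrable _ _)
  map_smul' a f := intervalIntegral.integral_const_mul a fun y => f (circlePoint y)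

theorem mem_range_dT_zero_iff (τ : TransverseForm 1) :
    τ ∈ LinearMap.range (dT 0) ↔ circleIntegralLin (formEquivOne.symm τ) = 0 := by
  constructor
  · rintro ⟨σ, rfl⟩
    obtain ⟨f, rfl⟩ := formEquivZero.surjective σ
    change ∫ y in (0 : ℝ)..1, formEquivOne.symm (dT 0 (formEquivZero f)) (circlePoint y) = 0
    simp only [formEquivOne_symm_dT]
    rw [intervalIntegral.integral_eq_sub_of_hasDerivAt
      (fun y _ => hasDerivAt_comp_circlePoint f y)
      (((contDiff_infty_iff_deriv.1 (contDiff_comp_circlePoint f)).2.continuous).intervalIntegrable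
        _ _)]
    have := circlePoint_add_one 0
    rw [zero_add] at this
    rw [this, sub_self]
  · obtain ⟨f, rfl⟩ := formEquivOne.surjective τ
    rw [LinearEquiv.symm_apply_apply]
    intro h
    have h : ∫ y in (0 : ℝ)..1, f (circlePoint y) = 0 := h
    have hc := (contDiff_comp_circlePoint f).continuous
    have hd : ∀ y, HasDerivAt (fun y => ∫ r in (0 : ℝ)..y, f (circlePoint r))
        (f (circlePoint y)) y := fun y => hc.integral_hasStrictDerivAt 0 y |>.hasDerivAt
    have hd' : deriv (fun y => ∫ r in (0 : ℝ)..y, f (circlePoint r)) =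
        fun y => f (circlePoint y) := funext fun y => (hd y).deriv
    -- The primitive from 0 grows over each period by the integral of `f` over a period, which is
    -- zero, so it descends to the circle.
    obtain ⟨F, hF⟩ := exists_smoothCircle (g := fun y => ∫ r in (0 : ℝ)..y, f (circlePoint r))
      (contDiff_infty_iff_deriv.2 ⟨fun y => (hd y).differentiableAt, by
        rw [hd']; exact contDiff_comp_circlePoint f⟩)
      (fun y => by
        have hp : Function.Periodic (fun y => f (circlePoint y)) 1 := fun y => by
          simp only [circlePoint_add_one]
        have h₁ := hp.intervalIntegral_add_eq y 0
        rw [zero_add, h] at h₁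
        simp only
        rw [← intervalIntegral.integral_add_adjacent_intervals
          (hc.intervalIntegrable 0 y) (hc.intervalIntegrable y (y + 1)), h₁, add_zero])
    refine ⟨formEquivZero F, formEquivOne.symm.injective (smoothCircle_ext fun y => ?_)⟩
    rw [formEquivOne_symm_dT, LinearEquiv.symm_apply_apply, funext hF, hd']

/-! ### The cohomologies -/

/-- The first isomorphism theorem for the restriction of `φ` to `Z`. All nine isomorphisms are
instances, with `φ` an evaluation, a coefficient or an integral. -/
theorem exists_quotient_equiv {V W : Type*} [AddCommGroup V] [Module ℝ V] [AddCommGroup W]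
    [Module ℝ W] (Z B : Submodule ℝ V) (φ : V →ₗ[ℝ] W) (hs : ∀ w, ∃ z ∈ Z, φ z = w)
    (hk : ∀ z ∈ Z, φ z = 0 ↔ z ∈ B) :
    ∃ h : (Z ⧸ B.submoduleOf Z) ≃ₗ[ℝ] W, ∀ z : Z, h (Submodule.Quotient.mk z) = φ z.1 := by
  have hker : B.submoduleOf Z = LinearMap.ker (φ ∘ₗ Z.subtype) := by
    ext z
    exact (hk z.1 z.2).symm
  have hsurj : Function.Surjective (φ ∘ₗ Z.subtype) := fun w => by
    obtain ⟨z, hz, rfl⟩ := hs w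
    exact ⟨⟨z, hz⟩, rfl⟩
  exact ⟨(Submodule.quotEquivOfEq _ _ hker).trans
    (LinearMap.quotKerEquivOfSurjective _ hsurj), fun z => rfl⟩

/-- Evaluation at the point `1` of the circle. -/
noncomputable def evalOne : SmoothCircle →ₗ[ℝ] ℝ where
  toFun f := f 1
  map_add' _ _ := rfl
  map_smul' _ _ := rfl

theorem exists_const_smoothCircle (a : ℝ) : ∃ f : SmoothCircle, ∀ c, f c = a :=
  ⟨⟨fun _ => a, contMDiff_const⟩, fun _ => rfl⟩

/-- Serves `HBasic 0`, `HSum 0` and `HSum 2`: the cocycles have constant coefficient and nothing is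
exact, so evaluation at any one point would do. -/
theorem exists_const_equiv {k : ℕ} {Z B : Submodule ℝ TotalForms}
    (e : TransverseForm k ≃ₗ[ℝ] SmoothCircle)
    (hZ : ∀ τ, τ ∈ degreePart Z k ↔ ∀ c c', e τ c = e τ c')
    (hB : ∀ τ, τ ∈ degreePart B k ↔ τ = 0) :
    ∃ h : Cohomology Z B k ≃ₗ[ℝ] ℝ,
      ∀ (z : degreePart Z k) c, e z.1 c = h (Submodule.Quotient.mk z) := by
  obtain ⟨h, hh⟩ := exists_quotient_equiv (degreePart Z k) (degreePart B k)
    (evalOne ∘ₗ e.toLinearMap) (fun a => by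
      obtain ⟨f, hf⟩ := exists_const_smoothCircle a
      refine ⟨e.symm f, (hZ _).2 fun c c' => ?_, ?_⟩
      · rw [e.apply_symm_apply, hf, hf]
      · change e (e.symm f) 1 = a
        rw [e.apply_symm_apply, hf]) (fun τ hτ => by
      rw [hB, ← e.map_eq_zero_iff]
      constructor
      · intro h₁
        ext c
        rw [(hZ τ).1 hτ c 1]
        exact h₁
      · intro h₁
        change e τ 1 = 0
        rw [h₁]
        rfl)
  refine ⟨h, fun z c => ?_⟩
  rw [hh, (hZ z.1).1 z.2 c 1]
  rfl

theorem exists_coeff_equiv {k : ℕ} {Z B : Submodule ℝ TotalForms}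
    (e : TransverseForm k ≃ₗ[ℝ] SmoothCircle) (hZ : ∀ τ, τ ∈ degreePart Z k)
    (hB : ∀ τ, τ ∈ degreePart B k ↔ τ = 0) :
    ∃ h : Cohomology Z B k ≃ₗ[ℝ] SmoothCircle,
      ∀ z : degreePart Z k, h (Submodule.Quotient.mk z) = e z.1 :=
  exists_quotient_equiv (degreePart Z k) (degreePart B k) e.toLinearMap
    (fun f => ⟨e.symm f, hZ _, e.apply_symm_apply f⟩)
    (fun τ _ => (e.map_eq_zero_iff).trans (hB τ).symm)

/-- Serves `HBasic 1` and `HProd 1`, where all 1-forms are cocycles and those with integral zero are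
divided out. -/
theorem exists_integral_equiv {Z B : Submodule ℝ TotalForms} (hZ : ∀ τ, τ ∈ degreePart Z 1)
    (hB : ∀ τ, τ ∈ degreePart B 1 ↔ τ ∈ LinearMap.range (dT 0)) :
    ∃ h : Cohomology Z B 1 ≃ₗ[ℝ] ℝ, ∀ z : degreePart Z 1, h (Submodule.Quotient.mk z) =
      ∫ y in (0 : ℝ)..1, formEquivOne.symm z.1 (circlePoint y) :=
  exists_quotient_equiv (degreePart Z 1) (degreePart B 1)
    (circleIntegralLin ∘ₗ formEquivOne.symm.toLinearMap)
    (fun a => by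
      obtain ⟨f, hf⟩ := exists_const_smoothCircle a
      refine ⟨formEquivOne f, hZ _, ?_⟩
      change ∫ y in (0 : ℝ)..1, formEquivOne.symm (formEquivOne f) (circlePoint y) = a
      simp [hf])
    (fun τ _ => (mem_range_dT_zero_iff τ).symm.trans (hB τ).symm)

theorem dT_zero_eq_zero_iff (τ : TransverseForm 0) :
    dT 0 τ = 0 ↔ ∀ c c', formEquivZero.symm τ c = formEquivZero.symm τ c' := by
  rw [← dT_formEquivZero_eq_zero_iff, LinearEquiv.apply_symm_apply]

theorem mem_degreePart_zero_iff {k : ℕ} (τ : TransverseForm k) :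
    τ ∈ degreePart (LinearMap.range (0 : TotalForms →ₗ[ℝ] TotalForms)) k ↔ τ = 0 := by
  rw [LinearMap.range_zero]
  exact Pi.single_eq_zero_iff

theorem mem_degreePart_ker_zero {k : ℕ} (τ : TransverseForm k) :
    τ ∈ degreePart (LinearMap.ker (0 : TotalForms →ₗ[ℝ] TotalForms)) k := by
  rw [LinearMap.ker_zero]
  exact Submodule.mem_top

theorem not_finiteDimensional_of_equiv {V : Type*} [AddCommGroup V] [Module ℝ V]
    (h : V ≃ₗ[ℝ] SmoothCircle) : ¬ FiniteDimensional ℝ V := fun _ =>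
  not_finiteDimensional_smoothCircle h.finiteDimensional

theorem areaForm_nondegenerate {u : Plane} (hu : u ≠ 0) : ∃ w, areaForm ![u, w] ≠ 0 := by
  by_contra! h
  refine hu ?_
  have h₀ := h (stdBasis 0)
  have h₁ := h (stdBasis 1)
  simp [areaForm_apply, stdBasis] at h₀ h₁
  ext i
  fin_cases i
  · exact h₁
  · exact h₀

end Suspension

theorem mainTheorem5 :
    -- `dx ∧ dy` is a transverse symplectic form
    ((fun _ => Suspension.areaForm) ∈ Suspension.transverseForms 2 ∧
      extDeriv (fun _ : Suspension.Plane => Suspension.areaForm) = 0 ∧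
      ∀ u : Suspension.Plane, u ≠ 0 → ∃ w, Suspension.areaForm ![u, w] ≠ 0) ∧
    -- basic forms on `M` are the invariant forms on the transversal, compatibly with `d`
    (∃ Φ : (k : ℕ) → Suspension.basicForms Suspension.leafTangent k ≃ₗ[ℝ]
          Suspension.TransverseForm k,
      (∀ k α, Suspension.Corresponds α.1 (Φ k α)) ∧
      ∀ k α, ∃ β : Suspension.basicForms Suspension.leafTangent (k + 1),
        β.1 = Suspension.extDerivForm α.1 ∧ Φ (k + 1) β = Suspension.dT k (Φ k α)) ∧
    -- they are `f(y)`, `f(y) dy` and `f(y) dx ∧ dy`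
    (∀ k, 3 ≤ k → Subsingleton (Suspension.TransverseForm k)) ∧
    ∃ (e₀ : Suspension.TransverseForm 0 ≃ₗ[ℝ] Suspension.SmoothCircle)
      (e₁ : Suspension.TransverseForm 1 ≃ₗ[ℝ] Suspension.SmoothCircle)
      (e₂ : Suspension.TransverseForm 2 ≃ₗ[ℝ] Suspension.SmoothCircle),
      (∀ τ v, τ.1 v = Suspension.scalar (e₀ τ (Suspension.circlePoint (v 1)))) ∧
      (∀ τ v, τ.1 v = e₁ τ (Suspension.circlePoint (v 1)) • Suspension.dy) ∧
      (∀ τ v, τ.1 v = e₂ τ (Suspension.circlePoint (v 1)) • Suspension.areaForm) ∧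
      -- basic cohomology
      (∃ h : Suspension.HBasic 0 ≃ₗ[ℝ] ℝ,
        ∀ z c, e₀ z.1 c = h (Submodule.Quotient.mk z)) ∧
      (∃ h : Suspension.HBasic 1 ≃ₗ[ℝ] ℝ,
        ∀ z, h (Submodule.Quotient.mk z) =
          ∫ y in (0 : ℝ)..1, e₁ z.1 (Suspension.circlePoint y)) ∧
      (∃ h : Suspension.HBasic 2 ≃ₗ[ℝ] Suspension.SmoothCircle,
        ∀ z, h (Submodule.Quotient.mk z) = e₂ z.1) ∧
      -- the `(d + d^Λ)`-cohomology
      (∃ h : Suspension.HSum 0 ≃ₗ[ℝ] ℝ,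
        ∀ z c, e₀ z.1 c = h (Submodule.Quotient.mk z)) ∧
      (∃ h : Suspension.HSum 1 ≃ₗ[ℝ] Suspension.SmoothCircle,
        ∀ z, h (Submodule.Quotient.mk z) = e₁ z.1) ∧
      (∃ h : Suspension.HSum 2 ≃ₗ[ℝ] ℝ,
        ∀ z c, e₂ z.1 c = h (Submodule.Quotient.mk z)) ∧
      -- the `d d^Λ`-cohomology
      (∃ h : Suspension.HProd 0 ≃ₗ[ℝ] Suspension.SmoothCircle,
        ∀ z, h (Submodule.Quotient.mk z) = e₀ z.1) ∧
      (∃ h : Suspension.HProd 1 ≃ₗ[ℝ] ℝ,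
        ∀ z, h (Submodule.Quotient.mk z) =
          ∫ y in (0 : ℝ)..1, e₁ z.1 (Suspension.circlePoint y)) ∧
      (∃ h : Suspension.HProd 2 ≃ₗ[ℝ] Suspension.SmoothCircle,
        ∀ z, h (Submodule.Quotient.mk z) = e₂ z.1) ∧
      -- infinite dimension
      ¬ FiniteDimensional ℝ (Suspension.HBasic 2) ∧
      ¬ FiniteDimensional ℝ (Suspension.HSum 1) ∧
      ¬ FiniteDimensional ℝ (Suspension.HProd 0) ∧
      ¬ FiniteDimensional ℝ (Suspension.HProd 2) := by
  open Suspension in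
  have hHB2 : ∃ h : HBasic 2 ≃ₗ[ℝ] SmoothCircle,
      ∀ z, h (Submodule.Quotient.mk z) = formEquivTwo.symm z.1 :=
    exists_coeff_equiv _ (degreePart_ker_dTot (by decide))
      (mem_degreePart_range_dTot (by decide))
  open Suspension in
  have hHS1 : ∃ h : HSum 1 ≃ₗ[ℝ] SmoothCircle,
      ∀ z, h (Submodule.Quotient.mk z) = formEquivOne.symm z.1 := by
    refine exists_coeff_equiv _ (fun τ => ?_) fun τ => ?_
    -- A form of degree 1 has no components in degrees 0 and 2, so the kernel equation is `0 = 0`.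
    · rw [mem_degreePart_ker_dTot_add_dLambda, Pi.single_eq_of_ne (by decide),
        Pi.single_eq_of_ne (by decide)]
      simp only [map_zero]
    · rw [dTot_comp_dLambda, mem_degreePart_zero_iff]
  open Suspension in
  have hHP : ∀ k, k ≠ 1 → ∀ e : TransverseForm k ≃ₗ[ℝ] SmoothCircle,
      ∃ h : HProd k ≃ₗ[ℝ] SmoothCircle, ∀ z, h (Submodule.Quotient.mk z) = e z.1 := by
    intro k hk e
    refine exists_coeff_equiv _ (fun τ => ?_) fun τ => ?_
    · rw [dTot_comp_dLambda]
      exact mem_degreePart_ker_zero τ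
    · rw [sup_eq_left.2 range_dLambda_le, mem_degreePart_range_dTot hk]
  refine ⟨⟨?_, ?_,
      fun u hu => Suspension.areaForm_nondegenerate hu⟩,
    ⟨Suspension.basicEquiv, fun k α => Suspension.corresponds_basicEquiv α,
      fun k α => Suspension.basicEquiv_extDerivForm α⟩,
    fun k hk => Suspension.subsingleton_transverseForm hk,
    Suspension.formEquivZero.symm, Suspension.formEquivOne.symm, Suspension.formEquivTwo.symm,
    fun τ v => ?_, fun τ v => ?_, fun τ v => ?_, ?_, ?_, hHB2, ?_, hHS1, ?_,
    hHP 0 (by decide) _, ?_, hHP 2 (by decide) _, ?_, ?_, ?_, ?_⟩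
  · exact ⟨contDiff_const, fun _ _ => rfl, fun _ => Suspension.areaForm_comp_linA⟩
  · funext v
    rw [extDeriv, fderiv_fun_const]
    exact map_zero (ContinuousAlternatingMap.alternatizeUncurryFinCLM ℝ _ ℝ)
  · rw [← Suspension.formEquivZero_apply, LinearEquiv.apply_symm_apply]
  · rw [← Suspension.formEquivOne_apply, LinearEquiv.apply_symm_apply]
  · rw [← Suspension.formEquivTwo_apply, LinearEquiv.apply_symm_apply]
  · exact Suspension.exists_const_equiv _
      (fun τ => (Suspension.mem_degreePart_ker_dTot_zero τ).trans
        (Suspension.dT_zero_eq_zero_iff τ))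
      (Suspension.mem_degreePart_range_dTot (by decide))
  · exact Suspension.exists_integral_equiv (Suspension.degreePart_ker_dTot (by decide))
      Suspension.mem_degreePart_range_dTot_one
  · refine Suspension.exists_const_equiv _ (fun τ => ?_) fun τ => ?_
    · rw [Suspension.mem_degreePart_ker_dTot_add_dLambda, Pi.single_eq_same,
        Pi.single_eq_of_ne (by decide), map_zero, map_zero, map_zero,
        Suspension.dT_zero_eq_zero_iff]
    · rw [Suspension.dTot_comp_dLambda, Suspension.mem_degreePart_zero_iff]
  · refine Suspension.exists_const_equiv _ (fun τ => ?_) fun τ => ?_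
    · rw [Suspension.mem_degreePart_ker_dTot_add_dLambda, Pi.single_eq_same,
        Pi.single_eq_of_ne (by decide), map_zero, eq_comm,
        Suspension.dT_formEquivZero_eq_zero_iff]
    · rw [Suspension.dTot_comp_dLambda, Suspension.mem_degreePart_zero_iff]
  · refine Suspension.exists_integral_equiv (fun τ => ?_) fun τ => ?_
    · rw [Suspension.dTot_comp_dLambda]
      exact Suspension.mem_degreePart_ker_zero τ
    · rw [sup_eq_left.2 Suspension.range_dLambda_le, Suspension.mem_degreePart_range_dTot_one]
  · exact Suspension.not_finiteDimensional_of_equiv hHB2.choose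
  · exact Suspension.not_finiteDimensional_of_equiv hHS1.choose
  · exact Suspension.not_finiteDimensional_of_equiv
      (hHP 0 (by decide) Suspension.formEquivZero.symm).choose
  · exact Suspension.not_finiteDimensional_of_equiv
      (hHP 2 (by decide) Suspension.formEquivTwo.symm).choose
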